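/- For $z\in\mathbb C$ put $\|z\|=\max\{|\operatorname{Re} z|,|\operatorname{Im} z|\}$ and let $[z]=\lfloor \operatorname{Re} z+\tfrac12\rfloor+i\lfloor \operatorname{Im} z+\tfrac12\rfloor$ be the nearest Gaussian integer. Let $\mathfrak F=\{z\in\mathbb C:[z]=0\}$, and let $T:\mathfrak F\to\mathfrak F$ be the complex Gauss map, $T(z)=z^{-1}-[z^{-1}]$ for $z\neq0$ and $T(0)=0$. The Hurwitz partial quotients of $z\in\mathfrak F$ are $a_n(z)=[(T^{n-1}(z))^{-1}]$, defined as long as $T^{n-1}(z)\ne0$. Let $\mathscr D=\{a\in\mathbb Z[i]:|a|\ge\sqrt2\}$. A word $\mathbf a=(a_1,\dots,a_n)\in\mathscr D^n$ is regular if its cylinder $\{z\in\mathfrak F: a_1(z)=a_1,\dots,a_n(z)=a_n\}$ has non-empty interior; let $\mathsf R(n)$ be the set of regular words of length $n$. Define $q_n(\mathbf a)$ by $q_{-1}=0$, $q_0=1$, $q_k=a_kq_{k-1}+q_{k-2}$ for $1\le k\le n$. For $B>1$ and $n\in\mathbb N$ put \[ s_{n,B}=\inf\Bigl\{\rho>0:\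 \sum_{\mathbf a\in\mathsf R(n)}\Bigl(\frac{5\sqrt2}{B^n\|q_n(\mathbf a)\|^2}\Bigr)^{\rho}\le 1\Bigr\},\qquad \inf\varnothing=+\infty, \] and $s_B=\lim_{n\to\infty}s_{n,B}$. Then for every $B>1$ the limit $s_B$ exists and is finite, and the function $(1,\infty)\to\mathbb R$, $B\mapsto s_B$, has the following properties: 1. $\lim_{B\to1^+}s_B=2$; 2. $\lim_{B\to\infty}s_B=1$; 3. it is continuous on $(1,\infty)$. -/

import Mathlib

open Filter Topology Set
open scoped ENNReal

noncomputable section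

namespace HurwitzCF

/-- The nearest Gaussian integer `[z] = ⌊Re z + 1/2⌋ + i ⌊Im z + 1/2⌋`. -/
def nearest (z : ℂ) : GaussianInt := ⟨⌊z.re + 1 / 2⌋, ⌊z.im + 1 / 2⌋⟩

/-- The fundamental square `𝔉 = {z : [z] = 0}`. -/
def square : Set ℂ := {z | nearest z = 0}

/-- The complex Gauss map: `T z = 1/z - [1/z]` for `z ≠ 0`, and `T 0 = 0`. -/
def gaussMap (z : ℂ) : ℂ := if z = 0 then 0 else z⁻¹ - (nearest z⁻¹ : ℂ)

/-- The digit set `𝒟 = {a ∈ ℤ[i] : |a| ≥ √2}`. -/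
def digits : Set GaussianInt := {a | √2 ≤ ‖(a : ℂ)‖}

/-- The cylinder of `z ∈ 𝔉` whose first `n` Hurwitz partial quotients exist and are the letters
of the word `a`. Letters are numbered from `0`: the `k`-th one is compared with the partial
quotient `a_{k+1}(z) = [1 / T^k z]`, which exists exactly when `T^k z ≠ 0`. -/
def cylinder {n : ℕ} (a : Fin n → GaussianInt) : Set ℂ :=
  {z | z ∈ square ∧
    ∀ k : Fin n, gaussMap^[k] z ≠ 0 ∧ nearest (gaussMap^[k] z)⁻¹ = a k}

/-- The set `R(n)` of regular words of length `n`: words over `𝒟` whose cylinder has non-empty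
interior. -/
def regularWords (n : ℕ) : Set (Fin n → GaussianInt) :=
  {a | (∀ k, a k ∈ digits) ∧ (interior (cylinder a)).Nonempty}

/-- Denominators of the convergents of a sequence (whose first entry is `a 0`):
`q_0 = 1`, `q_1 = a_1`, `q_n = a_n q_{n-1} + q_{n-2}`. -/
def denomSeq (a : ℕ → GaussianInt) : ℕ → GaussianInt
  | 0 => 1
  | 1 => a 0
  | n + 2 => a (n + 1) * denomSeq a (n + 1) + denomSeq a n

/-- The denominator `q_n(a_1, …, a_n)` of a word of length `n`. The padding by `0` beyond the
length of the word is never used. -/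
def denom {n : ℕ} (a : Fin n → GaussianInt) : GaussianInt :=
  denomSeq (fun k => if h : k < n then a ⟨k, h⟩ else 0) n

/-- `‖z‖ = max (|Re z|, |Im z|)`. -/
def supNorm (z : ℂ) : ℝ := max |z.re| |z.im|

/-- `g_n(ρ; B) = ∑ (5√2 / (B^n ‖q_n(a)‖²))^ρ` over the regular words `a` of length `n`,
as an element of `[0, ∞]`. -/
def g (n : ℕ) (ρ B : ℝ) : ℝ≥0∞ :=
  ∑' a : regularWords n,
    ENNReal.ofReal ((5 * √2 / (B ^ n * supNorm (denom a.1 : ℂ) ^ 2)) ^ ρ)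

/-- `s_{n,B} = inf {ρ > 0 : g_n(ρ; B) ≤ 1}`, in the extended reals (`inf ∅ = +∞`). -/
def sLevel (n : ℕ) (B : ℝ) : EReal :=
  sInf ((fun ρ : ℝ => (ρ : EReal)) '' {ρ : ℝ | 0 < ρ ∧ g n ρ B ≤ 1})

/-- `s_B = lim_{n → ∞} s_{n,B}`. -/
def s (B : ℝ) : ℝ := (limUnder atTop (fun n : ℕ => sLevel n B)).toReal

end HurwitzCF

end

noncomputable section

namespace HurwitzCF

/-! Let Z_n(ρ) be the sum of ‖q_n‖^{-2ρ} over regular words (`partitionFn`). Then g_n(ρ; B) =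
(5√2/B^n)^ρ Z_n(ρ) grows like exp(n(P(ρ) − ρ log B)), where P(ρ) = lim (1/n) log Z_n(ρ) for 1 < ρ ≤
2. Since P is nonincreasing, P(ρ) − ρ log B is strictly decreasing, and s_B is the point where its
sign changes (`criticalExponent`). Three facts locate this point: Z_n(ρ) = ∞ for ρ ≤ 1 and n ≥ 1
(`partitionFn_eq_top`), whereas P is finite on (1, 2]; P(2) ≤ 0; and P(ρ) ≥ (2 − ρ) log 2
(`le_pressure`). Continuity in B comes from that of log B alone.

P exists by Fekete's lemma, because Z_n is submultiplicative up to a constant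
(`partitionFn_add_le`). Indeed the factor ∏|T^k z|⁻¹ = |q_n + T^n z · q_{n-1}| is multiplicative
along orbits, and it is comparable with ‖q_n‖ because |q_{n-1}| < |q_n| (`normSq_denomPrev_lt`).

Z_n(2) is bounded above and below by an area count. On a cylinder T^n scales distances by a factor
comparable with ‖q_n‖². The image of a regular cylinder contains one of finitely many open pieces
cut out of the square by unit circles (`exists_mem_seqCylinder_of_sameSide`). Hence the cylinder has
area comparable with ‖q_n‖^{-4}, and the regular cylinders fill the square up to a null set. -/

/-! ### The square, the Gauss map and inversion of unit circles -/

lemma re_coe (g : GaussianInt) : (g : ℂ).re = (g.re : ℝ) := (GaussianInt.intCast_re g).symm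

lemma im_coe (g : GaussianInt) : (g : ℂ).im = (g.im : ℝ) := (GaussianInt.intCast_im g).symm

lemma mem_square_iff {z : ℂ} :
    z ∈ square ↔ (-(1 / 2) ≤ z.re ∧ z.re < 1 / 2) ∧ (-(1 / 2) ≤ z.im ∧ z.im < 1 / 2) := by
  simp only [square, nearest, mem_ofPred_eq, Zsqrtd.ext_iff, Zsqrtd.re_zero, Zsqrtd.im_zero,
    Int.floor_eq_zero_iff, mem_Ico]
  constructor <;> rintro ⟨⟨h1, h2⟩, h3, h4⟩ <;> refine ⟨⟨?_, ?_⟩, ?_, ?_⟩ <;> linarith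

lemma nearest_add_of_mem_square (a : GaussianInt) {w : ℂ} (hw : w ∈ square) :
    nearest ((a : ℂ) + w) = a := by
  rw [mem_square_iff] at hw
  simp only [nearest, Zsqrtd.ext_iff, Complex.add_re, Complex.add_im, re_coe,
    im_coe, Int.floor_eq_iff]
  refine ⟨⟨?_, ?_⟩, ?_, ?_⟩ <;> linarith [hw.1.1, hw.1.2, hw.2.1, hw.2.2]

lemma sub_nearest_mem_square (z : ℂ) : z - (nearest z : ℂ) ∈ square := by
  rw [mem_square_iff]
  simp only [nearest, Complex.sub_re, Complex.sub_im, re_coe,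
    im_coe]
  refine ⟨⟨?_, ?_⟩, ?_, ?_⟩ <;>
    linarith [Int.floor_le (z.re + 1 / 2), Int.lt_floor_add_one (z.re + 1 / 2),
      Int.floor_le (z.im + 1 / 2), Int.lt_floor_add_one (z.im + 1 / 2)]

lemma zero_mem_square : (0 : ℂ) ∈ square := by
  rw [mem_square_iff]; norm_num

lemma gaussMap_mem_square (z : ℂ) : gaussMap z ∈ square := by
  unfold gaussMap
  split_ifs
  · exact zero_mem_square
  · exact sub_nearest_mem_square _

lemma iterate_gaussMap_mem_square {z : ℂ} (hz : z ∈ square) (n : ℕ) :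
    gaussMap^[n] z ∈ square := by
  cases n with
  | zero => exact hz
  | succ n => rw [Function.iterate_succ_apply']; exact gaussMap_mem_square _

lemma normSq_le_of_mem_square {z : ℂ} (hz : z ∈ square) : Complex.normSq z ≤ 1 / 2 := by
  rw [mem_square_iff] at hz
  rw [Complex.normSq_apply]
  nlinarith [hz.1.1, hz.1.2, hz.2.1, hz.2.2]

lemma inv_eq_nearest_add_gaussMap {z : ℂ} (hz : z ≠ 0) :
    z⁻¹ = (nearest z⁻¹ : ℂ) + gaussMap z := by
  simp [gaussMap, hz]

lemma gaussMap_inv_add (a : GaussianInt) {w : ℂ} (hw : w ∈ square) (h : (a : ℂ) + w ≠ 0) :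
    gaussMap ((a : ℂ) + w)⁻¹ = w := by
  simp [gaussMap, h, nearest_add_of_mem_square a hw]

/-- The squared distances of `u⁻¹` to the Gaussian integers, up to the factor `|u|²`. -/
lemma normSq_inv_sub_mul {u : ℂ} (hu : u ≠ 0) (g : ℂ) :
    Complex.normSq (u⁻¹ - g) * Complex.normSq u =
      1 - 2 * (g * u).re + Complex.normSq g * Complex.normSq u := by
  rw [← Complex.normSq_mul, sub_mul, inv_mul_cancel₀ hu]
  simp only [Complex.normSq_apply, Complex.sub_re, Complex.sub_im, Complex.mul_re, Complex.mul_im,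
    Complex.one_re, Complex.one_im]
  ring

lemma normSq_toComplex (g : GaussianInt) :
    Complex.normSq (g : ℂ) = ((g.re ^ 2 + g.im ^ 2 : ℤ) : ℝ) := by
  rw [Complex.normSq_apply, re_coe, im_coe]
  push_cast
  ring

/-- No sum of two squares equals 3. Under inversion, unit discs around Gaussian integers behave
differently in each of these four classes. -/
lemma norm_cases (g : GaussianInt) :
    g = 0 ∨ g.re ^ 2 + g.im ^ 2 = 1 ∨ g.re ^ 2 + g.im ^ 2 = 2 ∨ 4 ≤ g.re ^ 2 + g.im ^ 2 := by
  obtain ⟨x, y⟩ := g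
  simp only [Zsqrtd.ext_iff, Zsqrtd.re_zero, Zsqrtd.im_zero]
  by_contra! h
  obtain ⟨h0, h1, h2, h4⟩ := h
  have hx : x ≤ 1 := by nlinarith [sq_nonneg y]
  have hx' : -1 ≤ x := by nlinarith [sq_nonneg y]
  have hy : y ≤ 1 := by nlinarith [sq_nonneg x]
  have hy' : -1 ≤ y := by nlinarith [sq_nonneg x]
  interval_cases x <;> interval_cases y <;> simp_all

lemma unit_cases {g : GaussianInt} (h : g.re ^ 2 + g.im ^ 2 = 1) :
    (g.re = 1 ∧ g.im = 0) ∨ (g.re = -1 ∧ g.im = 0) ∨ (g.re = 0 ∧ g.im = 1) ∨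
      (g.re = 0 ∧ g.im = -1) := by
  obtain ⟨x, y⟩ := g
  simp only at h ⊢
  have hx : x ≤ 1 := by nlinarith [sq_nonneg y]
  have hx' : -1 ≤ x := by nlinarith [sq_nonneg y]
  have hy : y ≤ 1 := by nlinarith [sq_nonneg x]
  have hy' : -1 ≤ y := by nlinarith [sq_nonneg x]
  interval_cases x <;> interval_cases y <;> simp_all

/-- The inverse of a point of the square lies outside the discs around the units. -/
lemma one_le_normSq_inv_sub_unit {t : ℂ} (ht : t ∈ square) (h0 : t ≠ 0) {g : GaussianInt}
    (hg : g.re ^ 2 + g.im ^ 2 = 1) : 1 ≤ Complex.normSq (t⁻¹ - (g : ℂ)) := by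
  have key := normSq_inv_sub_mul h0 (g : ℂ)
  rw [normSq_toComplex, hg] at key
  have hpos := Complex.normSq_pos.2 h0
  -- The unit circle around a unit g passes through 0, so inversion turns it into the line Re(g t) =
  -- 1/2, which carries a side of the square.
  have hre : ((g : ℂ) * t).re ≤ 1 / 2 := by
    rw [mem_square_iff] at ht
    simp only [Complex.mul_re, re_coe, im_coe]
    rcases unit_cases hg with ⟨h1, h2⟩ | ⟨h1, h2⟩ | ⟨h1, h2⟩ | ⟨h1, h2⟩ <;> rw [h1, h2] <;>
      push_cast <;> linarith [ht.1.1, ht.1.2, ht.2.1, ht.2.2]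
  push_cast at key
  by_contra! hlt
  nlinarith

lemma two_le_normSq_inv {t : ℂ} (ht : t ∈ square) (h0 : t ≠ 0) : 2 ≤ Complex.normSq t⁻¹ := by
  rw [Complex.normSq_inv, le_inv_comm₀ two_pos (Complex.normSq_pos.2 h0)]
  linarith [normSq_le_of_mem_square ht]

/-- For `|g|² = 2` the inversion exchanges the discs around `g` and its conjugate. -/
lemma normSq_inv_sub_mul_of_two {u : ℂ} (hu : u ≠ 0) {g : GaussianInt}
    (hg : g.re ^ 2 + g.im ^ 2 = 2) :
    (Complex.normSq (u⁻¹ - (g : ℂ)) - 1) * Complex.normSq u =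
      Complex.normSq (u - (star g : GaussianInt)) - 1 := by
  have key := normSq_inv_sub_mul hu (g : ℂ)
  have hg' : (g.re : ℝ) ^ 2 + (g.im : ℝ) ^ 2 = 2 := by exact_mod_cast hg
  rw [normSq_toComplex, hg] at key
  rw [sub_mul, key]
  simp only [Complex.normSq_apply, Complex.sub_re, Complex.sub_im, Complex.mul_re,
    re_coe, im_coe, Zsqrtd.re_star, Zsqrtd.im_star]
  push_cast
  linear_combination -hg'

lemma nearest_inv_mem_digits {t : ℂ} (ht : t ∈ square) (h0 : t ≠ 0) :
    nearest t⁻¹ ∈ digits := by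
  set a := nearest t⁻¹ with ha
  have hw : Complex.normSq (t⁻¹ - (a : ℂ)) ≤ 1 / 2 :=
    normSq_le_of_mem_square (sub_nearest_mem_square _)
  have h2 : 2 ≤ a.re ^ 2 + a.im ^ 2 := by
    rcases norm_cases a with h | h | h | h
    · rw [h] at hw
      have := two_le_normSq_inv ht h0
      simp only [map_zero, sub_zero] at hw
      linarith
    · linarith [one_le_normSq_inv_sub_unit ht h0 h]
    · omega
    · omega
  simp only [digits, mem_ofPred_eq]
  rw [Complex.norm_def, normSq_toComplex]
  exact Real.sqrt_le_sqrt (by exact_mod_cast h2)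

/-! ### Denominators and their growth -/

/-- The Hurwitz partial quotients of `z`, numbered from `0`. -/
def digit (z : ℂ) (k : ℕ) : GaussianInt := nearest (gaussMap^[k] z)⁻¹

/-- The denominators with the index shifted by one: `q_{n-1}`, where `q_{-1} = 0`. -/
def denomPrev (a : ℕ → GaussianInt) : ℕ → GaussianInt
  | 0 => 0
  | n + 1 => denomSeq a n

lemma denomSeq_succ (a : ℕ → GaussianInt) (n : ℕ) :
    denomSeq a (n + 1) = a n * denomSeq a n + denomPrev a n := by
  cases n <;> simp [denomSeq, denomPrev]

lemma denomSeq_congr_aux {a b : ℕ → GaussianInt} (n : ℕ) (h : ∀ k < n, a k = b k) :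
    denomSeq a n = denomSeq b n ∧ denomPrev a n = denomPrev b n := by
  induction n with
  | zero => simp [denomSeq, denomPrev]
  | succ n ih =>
    obtain ⟨h1, h2⟩ := ih fun k hk => h k (by omega)
    exact ⟨by rw [denomSeq_succ, denomSeq_succ, h1, h2, h n (by omega)], h1⟩

lemma denomSeq_congr {a b : ℕ → GaussianInt} {n : ℕ} (h : ∀ k < n, a k = b k) :
    denomSeq a n = denomSeq b n :=
  (denomSeq_congr_aux n h).1

/-- Points of the square with at least `n` partial quotients. -/
def longExpansion (n : ℕ) : Set ℂ := {z | z ∈ square ∧ ∀ k < n, gaussMap^[k] z ≠ 0}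

lemma longExpansion_anti {m n : ℕ} (h : m ≤ n) : longExpansion n ⊆ longExpansion m :=
  fun _ hz => ⟨hz.1, fun k hk => hz.2 k (by omega)⟩

lemma inv_iterate_eq {z : ℂ} {n : ℕ} (h : gaussMap^[n] z ≠ 0) :
    (gaussMap^[n] z)⁻¹ = (digit z n : ℂ) + gaussMap^[n + 1] z := by
  rw [Function.iterate_succ_apply']
  exact inv_eq_nearest_add_gaussMap h

/-- Multiply q_n + T^n z · q_{n-1} by 1/T^n z = a_{n+1} + T^{n+1} z and use the recursion. All size
estimates for q_n rest on this identity. -/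
lemma prod_inv_iterate {z : ℂ} {n : ℕ} (hz : z ∈ longExpansion n) :
    ∏ k ∈ Finset.range n, (gaussMap^[k] z)⁻¹ =
      (denomSeq (digit z) n : ℂ) + gaussMap^[n] z * (denomPrev (digit z) n : ℂ) := by
  induction n with
  | zero => simp [denomSeq, denomPrev]
  | succ n ih =>
    have h0 : gaussMap^[n] z ≠ 0 := hz.2 n (by omega)
    rw [Finset.prod_range_succ, ih (longExpansion_anti (by omega) hz), denomSeq_succ, add_mul,
      mul_right_comm, mul_inv_cancel₀ h0, inv_iterate_eq h0]
    simp only [denomPrev, map_add, map_mul]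
    ring

/-- The pair `(T^n z, -q_n / q_{n-1})` never lies in one closed unit disc around a Gaussian
integer, provided that `T^n z` lies in the open one. -/
lemma normSq_denomPrev_lt {z : ℂ} {n : ℕ} (hz : z ∈ longExpansion n) (g : GaussianInt)
    (hg : Complex.normSq (gaussMap^[n] z - (g : ℂ)) < 1) :
    Complex.normSq (denomPrev (digit z) n : ℂ) <
      Complex.normSq ((denomSeq (digit z) n : ℂ) + (g : ℂ) * (denomPrev (digit z) n : ℂ)) := by
  -- The induction carries all discs at once: for a letter of modulus √2 the triangle inequality
  -- alone does not give |q_n| < |q_{n+1}|.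
  induction n generalizing g with
  | zero => simp [denomSeq, denomPrev]
  | succ n ih =>
    have hz' := longExpansion_anti (Nat.le_succ n) hz
    have h0 : gaussMap^[n] z ≠ 0 := hz.2 n (by omega)
    have hsq := iterate_gaussMap_mem_square hz.1 n
    set t := gaussMap^[n] z
    -- With this h, T^{n+1} z − g = 1/t − h and q_{n+1} + g q_n = h q_n + q_{n-1}.
    set h : GaussianInt := g + digit z n with hh
    have hgc : (g : ℂ) = (h : ℂ) - (digit z n : ℂ) := by simp [hh]
    have hth : gaussMap^[n + 1] z - (g : ℂ) = t⁻¹ - (h : ℂ) := by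
      rw [inv_iterate_eq h0, hgc]; ring
    rw [hth] at hg
    rw [denomSeq_succ, hgc, GaussianInt.toComplex_add, GaussianInt.toComplex_mul]
    change Complex.normSq (denomSeq (digit z) n : ℂ) <
      Complex.normSq (_ + _ * (denomSeq (digit z) n : ℂ))
    set x := (denomSeq (digit z) n : ℂ)
    set y := (denomPrev (digit z) n : ℂ)
    rw [show (digit z n : ℂ) * x + y + ((h : ℂ) - (digit z n : ℂ)) * x = (h : ℂ) * x + y by ring]
    have hyx : Complex.normSq y < Complex.normSq x := by
      have := ih hz' 0 (by
        simp only [map_zero, sub_zero]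
        linarith [normSq_le_of_mem_square hsq])
      simpa using this
    -- If h is 0 or a unit, 1/t cannot lie in its disc. If |h|² = 2, inversion moves t into the disc
    -- around the conjugate of h, where the induction hypothesis applies. If |h| ≥ 2, the triangle
    -- inequality suffices.
    rcases norm_cases h with h' | h' | h' | h'
    · have := two_le_normSq_inv hsq h0
      rw [h', map_zero, sub_zero] at hg
      linarith
    · linarith [one_le_normSq_inv_sub_unit hsq h0 h']
    · have h2 := normSq_inv_sub_mul_of_two h0 h'
      have hpos := Complex.normSq_pos.2 h0
      have h3 : Complex.normSq (t - (star h : GaussianInt)) < 1 := by nlinarith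
      have h4 := ih hz' (star h) h3
      have hg' : (h.re : ℝ) ^ 2 + (h.im : ℝ) ^ 2 = 2 := by exact_mod_cast h'
      simp only [Complex.normSq_apply, Complex.add_re, Complex.add_im, Complex.mul_re,
        Complex.mul_im, re_coe, im_coe, Zsqrtd.re_star,
        Zsqrtd.im_star] at h4 ⊢
      push_cast at h4
      -- For |h|² = 2 this is |hx + y|² − |x|² = |x + h̄y|² − |y|².
      have e : ((h.re : ℝ) * x.re - h.im * x.im + y.re) * (h.re * x.re - h.im * x.im + y.re) +
          (h.re * x.im + h.im * x.re + y.im) * (h.re * x.im + h.im * x.re + y.im) -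
          (x.re * x.re + x.im * x.im) =
          (x.re + (h.re * y.re - -h.im * y.im)) * (x.re + (h.re * y.re - -h.im * y.im)) +
          (x.im + (h.re * y.im + -h.im * y.re)) * (x.im + (h.re * y.im + -h.im * y.re)) -
          (y.re * y.re + y.im * y.im) := by
        linear_combination (x.re ^ 2 + x.im ^ 2 - y.re ^ 2 - y.im ^ 2) * hg'
      linarith
    · have hn : (2 : ℝ) ≤ ‖(h : ℂ)‖ := by
        rw [Complex.norm_def, normSq_toComplex]
        exact Real.le_sqrt_of_sq_le (by
          rw [show (2 : ℝ) ^ 2 = ((4 : ℤ) : ℝ) by norm_num]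
          exact Int.cast_le.2 h')
      rw [Complex.normSq_eq_norm_sq, Complex.normSq_eq_norm_sq,
        pow_lt_pow_iff_left₀ (norm_nonneg _) (norm_nonneg _) two_ne_zero] at hyx ⊢
      have h5 := norm_sub_le ((h : ℂ) * x + y) y
      rw [add_sub_cancel_right, norm_mul] at h5
      nlinarith [norm_nonneg x]

lemma norm_denomPrev_lt {z : ℂ} {n : ℕ} (hz : z ∈ longExpansion n) :
    ‖(denomPrev (digit z) n : ℂ)‖ < ‖(denomSeq (digit z) n : ℂ)‖ := by
  have h := normSq_denomPrev_lt hz 0 (by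
    simp only [map_zero, sub_zero]
    linarith [normSq_le_of_mem_square (iterate_gaussMap_mem_square hz.1 n)])
  simp only [map_zero, zero_mul, add_zero] at h
  rwa [Complex.normSq_eq_norm_sq, Complex.normSq_eq_norm_sq,
    pow_lt_pow_iff_left₀ (norm_nonneg _) (norm_nonneg _) two_ne_zero] at h

lemma norm_sq_le_of_mem_square {z : ℂ} (hz : z ∈ square) : ‖z‖ ^ 2 ≤ 1 / 2 := by
  rw [← Complex.normSq_eq_norm_sq]; exact normSq_le_of_mem_square hz

lemma norm_le_of_mem_square {z : ℂ} (hz : z ∈ square) : ‖z‖ ≤ 3 / 4 := by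
  nlinarith [norm_sq_le_of_mem_square hz, norm_nonneg z]

/-! ### Expansion factor versus denominator -/

/-- The expansion factor `∏_{k<n} |T^k z|⁻¹`, the square root of `|(T^n)'(z)|`. -/
def expansion (n : ℕ) (z : ℂ) : ℝ := ∏ k ∈ Finset.range n, ‖gaussMap^[k] z‖⁻¹

lemma expansion_eq {z : ℂ} {n : ℕ} (hz : z ∈ longExpansion n) :
    expansion n z =
      ‖(denomSeq (digit z) n : ℂ) + gaussMap^[n] z * (denomPrev (digit z) n : ℂ)‖ := by
  rw [← prod_inv_iterate hz, norm_prod]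
  simp [expansion]

lemma expansion_add (n m : ℕ) (z : ℂ) :
    expansion (n + m) z = expansion n z * expansion m (gaussMap^[n] z) := by
  simp only [expansion, Finset.prod_range_add, ← Function.iterate_add_apply, add_comm]

lemma supNorm_le_norm (z : ℂ) : supNorm z ≤ ‖z‖ :=
  max_le (Complex.abs_re_le_norm z) (Complex.abs_im_le_norm z)

lemma norm_le_supNorm (z : ℂ) : ‖z‖ ≤ √2 * supNorm z := Complex.norm_le_sqrt_two_mul_max z

/-- Since |T^n z| ≤ 3/4 and |q_{n-1}| < |q_n|, the factor lies between |q_n|/4 and (7/4)|q_n|, and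
(7/4)√2 < 3. The lower half is `le_expansion`. -/
lemma expansion_le {z : ℂ} {n : ℕ} (hz : z ∈ longExpansion n) :
    expansion n z ≤ 3 * supNorm (denomSeq (digit z) n : ℂ) := by
  rw [expansion_eq hz]
  have h1 := norm_add_le (denomSeq (digit z) n : ℂ)
    (gaussMap^[n] z * (denomPrev (digit z) n : ℂ))
  rw [norm_mul] at h1
  have h2 := norm_le_of_mem_square (iterate_gaussMap_mem_square hz.1 n)
  have h3 := norm_denomPrev_lt hz
  have h4 := norm_le_supNorm (denomSeq (digit z) n : ℂ)
  have h5 : √2 ≤ 3 / 2 := Real.sqrt_le_iff.2 (by norm_num)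
  have h6 : ‖gaussMap^[n] z‖ * ‖(denomPrev (digit z) n : ℂ)‖ ≤
      3 / 4 * ‖(denomSeq (digit z) n : ℂ)‖ := by gcongr
  have h7 : 0 ≤ supNorm (denomSeq (digit z) n : ℂ) := le_max_of_le_left (abs_nonneg _)
  nlinarith

lemma le_expansion {z : ℂ} {n : ℕ} (hz : z ∈ longExpansion n) :
    supNorm (denomSeq (digit z) n : ℂ) / 4 ≤ expansion n z := by
  rw [expansion_eq hz]
  have h1 := norm_sub_le_norm_add (denomSeq (digit z) n : ℂ)
    (gaussMap^[n] z * (denomPrev (digit z) n : ℂ))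
  rw [norm_mul] at h1
  have h2 := norm_le_of_mem_square (iterate_gaussMap_mem_square hz.1 n)
  have h3 := norm_denomPrev_lt hz
  have h4 := supNorm_le_norm (denomSeq (digit z) n : ℂ)
  have h6 : ‖gaussMap^[n] z‖ * ‖(denomPrev (digit z) n : ℂ)‖ ≤
      3 / 4 * ‖(denomSeq (digit z) n : ℂ)‖ := by gcongr
  linarith

lemma sqrt_two_pow_le_expansion {z : ℂ} {n : ℕ} (hz : z ∈ longExpansion n) :
    √2 ^ n ≤ expansion n z := by
  have : √2 ^ n = ∏ _k ∈ Finset.range n, √2 := by simp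
  rw [this, expansion]
  refine Finset.prod_le_prod (fun _ _ => by positivity) fun k hk => ?_
  rw [Finset.mem_range] at hk
  rw [← norm_inv, Complex.norm_def]
  exact Real.sqrt_le_sqrt (two_le_normSq_inv (iterate_gaussMap_mem_square hz.1 k) (hz.2 k hk))

lemma expansion_pos {z : ℂ} {n : ℕ} (hz : z ∈ longExpansion n) : 0 < expansion n z :=
  lt_of_lt_of_le (by positivity) (sqrt_two_pow_le_expansion hz)

lemma one_le_supNorm {g : GaussianInt} (hg : g ≠ 0) : 1 ≤ supNorm (g : ℂ) := by
  simp only [supNorm, re_coe, im_coe, le_max_iff]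
  by_contra! h
  have h1 : |g.re| < 1 := by exact_mod_cast h.1
  have h2 : |g.im| < 1 := by exact_mod_cast h.2
  exact hg (Zsqrtd.ext (Int.abs_lt_one_iff.1 h1) (Int.abs_lt_one_iff.1 h2))

lemma denomSeq_ne_zero {z : ℂ} {n : ℕ} (hz : z ∈ longExpansion n) :
    denomSeq (digit z) n ≠ 0 := by
  intro h
  have := norm_denomPrev_lt hz
  rw [h, map_zero, norm_zero] at this
  exact absurd this (norm_nonneg _).not_gt

/-! ### Cylinders, generic points and the finite range structure -/

/-- Points with `n` partial quotients, equal to the first terms of the sequence `a`. -/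
def seqCylinder (a : ℕ → GaussianInt) (n : ℕ) : Set ℂ :=
  {z | z ∈ square ∧ ∀ k < n, gaussMap^[k] z ≠ 0 ∧ digit z k = a k}

lemma seqCylinder_subset_longExpansion (a : ℕ → GaussianInt) (n : ℕ) :
    seqCylinder a n ⊆ longExpansion n :=
  fun _ hz => ⟨hz.1, fun k hk => (hz.2 k hk).1⟩

/-- Interior points of the square that lie on no unit circle around a Gaussian integer. -/
def generic : Set ℂ :=
  {w | ((-(1 / 2) < w.re ∧ w.re < 1 / 2) ∧ (-(1 / 2) < w.im ∧ w.im < 1 / 2)) ∧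
    ∀ g : GaussianInt, Complex.normSq (w - (g : ℂ)) ≠ 1}

lemma generic_subset_square : generic ⊆ square := fun _ hw =>
  mem_square_iff.2 ⟨⟨hw.1.1.1.le, hw.1.1.2⟩, hw.1.2.1.le, hw.1.2.2⟩

/-- Two points lie in the same open unit discs around Gaussian integers. -/
def SameSide (w w' : ℂ) : Prop :=
  ∀ g : GaussianInt, Complex.normSq (w - (g : ℂ)) < 1 ↔ Complex.normSq (w' - (g : ℂ)) < 1

lemma one_lt_normSq_sub_of_four_le {t : ℂ} (ht : t ∈ square) {g : GaussianInt}
    (hg : 4 ≤ g.re ^ 2 + g.im ^ 2) : 1 < Complex.normSq (t - (g : ℂ)) := by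
  have hn : (2 : ℝ) ≤ ‖(g : ℂ)‖ := by
    rw [Complex.norm_def, normSq_toComplex]
    refine Real.le_sqrt_of_sq_le ?_
    rw [show (2 : ℝ) ^ 2 = ((4 : ℤ) : ℝ) by norm_num]
    exact Int.cast_le.2 hg
  have h1 := norm_le_of_mem_square ht
  have h2 := norm_sub_le t (t - (g : ℂ))
  rw [sub_sub_cancel] at h2
  rw [Complex.normSq_eq_norm_sq]
  nlinarith

lemma int_add_ne_half (m : ℤ) {x : ℝ} (hx : -(1 / 2) < x) (hx' : x < 1 / 2) :
    (m : ℝ) + x ≠ 1 / 2 ∧ (1 / 2 < (m : ℝ) + x ↔ 0 < m) := by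
  rcases le_or_gt m 0 with h | h
  · have : (m : ℝ) ≤ 0 := by exact_mod_cast h
    exact ⟨by linarith, ⟨fun _ => by linarith, fun _ => by omega⟩⟩
  · have : (1 : ℝ) ≤ m := by exact_mod_cast h
    exact ⟨by linarith, ⟨fun _ => h, fun _ => by linarith⟩⟩

lemma re_unit_mul_lt_half {w : ℂ} (hw : w ∈ generic) {g : GaussianInt}
    (hg : g.re ^ 2 + g.im ^ 2 = 1) : -(1 / 2) < ((g : ℂ) * w).re ∧ ((g : ℂ) * w).re < 1 / 2 := by
  obtain ⟨⟨⟨h1, h2⟩, h3, h4⟩, -⟩ := hw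
  simp only [Complex.mul_re, re_coe, im_coe]
  rcases unit_cases hg with ⟨h, h'⟩ | ⟨h, h'⟩ | ⟨h, h'⟩ | ⟨h, h'⟩ <;> rw [h, h'] <;>
    push_cast <;> constructor <;> linarith

/-- Being in the disc around g after inversion means Re(g(a + w)) > 1/2. As |Re(g w)| < 1/2 for
generic w, only the integer Re(g a) matters. -/
lemma normSq_inv_sub_unit {a g : GaussianInt} {w : ℂ} (hw : w ∈ generic) (hu : (a : ℂ) + w ≠ 0)
    (hg : g.re ^ 2 + g.im ^ 2 = 1) :
    Complex.normSq (((a : ℂ) + w)⁻¹ - (g : ℂ)) ≠ 1 ∧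
      (Complex.normSq (((a : ℂ) + w)⁻¹ - (g : ℂ)) < 1 ↔ 0 < (g * a).re) := by
  have key := normSq_inv_sub_mul hu (g : ℂ)
  rw [normSq_toComplex, hg] at key
  have hpos := Complex.normSq_pos.2 hu
  obtain ⟨h1, h2⟩ := re_unit_mul_lt_half hw hg
  obtain ⟨h3, h4⟩ := int_add_ne_half (g * a).re h1 h2
  have hre : ((g : ℂ) * ((a : ℂ) + w)).re = ((g * a).re : ℝ) + ((g : ℂ) * w).re := by
    rw [mul_add, Complex.add_re, ← GaussianInt.toComplex_mul, re_coe]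
  rw [hre] at key
  push_cast at key
  refine ⟨fun h => h3 (by rw [h] at key; linarith), ?_⟩
  rw [← h4]
  constructor <;> intro h <;> nlinarith

/-- Inverse branches of the Gauss map preserve generic points and their position with respect to
the unit circles around Gaussian integers. -/
lemma inv_add_mem_generic {a : GaussianInt} {w w' : ℂ} (hw : w ∈ generic) (hw' : w' ∈ generic)
    (h : SameSide w w') (hu : (a : ℂ) + w ≠ 0) (ht : ((a : ℂ) + w)⁻¹ ∈ square) :
    (a : ℂ) + w' ≠ 0 ∧ ((a : ℂ) + w')⁻¹ ∈ generic ∧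
      SameSide ((a : ℂ) + w)⁻¹ ((a : ℂ) + w')⁻¹ := by
  have shift : ∀ (v : ℂ) (g : GaussianInt),
      (a : ℂ) + v - (g : ℂ) = v - ((g - a : GaussianInt) : ℂ) := fun v g => by
    rw [GaussianInt.toComplex_sub]; ring
  have D : ∀ g : GaussianInt, Complex.normSq ((a : ℂ) + w - (g : ℂ)) < 1 ↔
      Complex.normSq ((a : ℂ) + w' - (g : ℂ)) < 1 := fun g => by
    rw [shift, shift]; exact h _
  have N : ∀ v ∈ generic, ∀ g : GaussianInt, Complex.normSq ((a : ℂ) + v - (g : ℂ)) ≠ 1 :=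
    fun v hv g => by rw [shift]; exact hv.2 _
  -- A weak inequality for w becomes strict for w', which lies on no unit circle.
  have far : ∀ g : GaussianInt, 1 ≤ Complex.normSq ((a : ℂ) + w - (g : ℂ)) →
      1 < Complex.normSq ((a : ℂ) + w' - (g : ℂ)) := fun g hg =>
    lt_of_le_of_ne (not_lt.1 fun hlt => (not_lt.2 hg) ((D g).2 hlt)) (N w' hw' g).symm
  have hunit : ∀ g : GaussianInt, g.re ^ 2 + g.im ^ 2 = 1 →
      1 < Complex.normSq ((a : ℂ) + w' - (g : ℂ)) := fun g hg => far g (by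
    have := one_le_normSq_inv_sub_unit ht (inv_ne_zero hu) hg
    rwa [inv_inv] at this)
  have hu' : (a : ℂ) + w' ≠ 0 := by
    intro h0
    have h1 := far 0 (by
      have := two_le_normSq_inv ht (inv_ne_zero hu)
      rw [inv_inv] at this
      rw [map_zero, sub_zero]
      linarith)
    rw [h0] at h1
    simp at h1
    linarith
  set u := (a : ℂ) + w with hu_def
  set u' := (a : ℂ) + w' with hu'_def
  have hpos := Complex.normSq_pos.2 hu
  have hpos' := Complex.normSq_pos.2 hu'
  -- Lying strictly outside the unit discs around the four units is the same as having the inverse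
  -- in the open square.
  have inner : (-(1 / 2) < (u'⁻¹).re ∧ (u'⁻¹).re < 1 / 2) ∧
      (-(1 / 2) < (u'⁻¹).im ∧ (u'⁻¹).im < 1 / 2) := by
    have e : ∀ g : GaussianInt, Complex.normSq (u' - (g : ℂ)) =
        Complex.normSq u' - 2 * (u'.re * g.re + u'.im * g.im) + (g.re ^ 2 + g.im ^ 2 : ℤ) := by
      intro g
      simp only [Complex.normSq_apply, Complex.sub_re, Complex.sub_im, re_coe, im_coe]
      push_cast
      ring
    have h1 := hunit ⟨1, 0⟩ (by norm_num)
    have h2 := hunit ⟨-1, 0⟩ (by norm_num)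
    have h3 := hunit ⟨0, 1⟩ (by norm_num)
    have h4 := hunit ⟨0, -1⟩ (by norm_num)
    rw [e] at h1 h2 h3 h4
    norm_num at h1 h2 h3 h4
    rw [Complex.inv_re, Complex.inv_im, lt_div_iff₀ hpos', div_lt_iff₀ hpos', lt_div_iff₀ hpos',
      div_lt_iff₀ hpos']
    refine ⟨⟨?_, ?_⟩, ?_, ?_⟩ <;> linarith
  have ht' : u'⁻¹ ∈ square :=
    mem_square_iff.2 ⟨⟨inner.1.1.le, inner.1.2⟩, inner.2.1.le, inner.2.2⟩
  have main : ∀ g : GaussianInt, Complex.normSq (u'⁻¹ - (g : ℂ)) ≠ 1 ∧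
      (Complex.normSq (u⁻¹ - (g : ℂ)) < 1 ↔ Complex.normSq (u'⁻¹ - (g : ℂ)) < 1) := by
    intro g
    -- The disc around 0 contains the square and those with |g| ≥ 2 miss it. For units the answer
    -- depends on a only. For |g|² = 2 inversion passes to the disc around the conjugate, where w
    -- and w' are assumed to agree.
    rcases norm_cases g with hg | hg | hg | hg
    · have h1 := normSq_le_of_mem_square ht
      have h2 := normSq_le_of_mem_square ht'
      rw [hg, map_zero, sub_zero, sub_zero]
      exact ⟨by linarith, ⟨fun _ => by linarith, fun _ => by linarith⟩⟩
    · have h1 := normSq_inv_sub_unit hw hu hg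
      have h2 := normSq_inv_sub_unit hw' hu' hg
      exact ⟨h2.1, h1.2.trans h2.2.symm⟩
    · have h1 := normSq_inv_sub_mul_of_two hu hg
      have h2 := normSq_inv_sub_mul_of_two hu' hg
      have h3 := D (star g)
      have h4 := N w' hw' (star g)
      refine ⟨fun h => h4 ?_, ?_⟩
      · rw [h] at h2; linarith
      · have e1 : Complex.normSq (u⁻¹ - (g : ℂ)) < 1 ↔
            Complex.normSq (u - (star g : GaussianInt)) < 1 := by
          constructor <;> intro h <;> nlinarith
        have e2 : Complex.normSq (u'⁻¹ - (g : ℂ)) < 1 ↔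
            Complex.normSq (u' - (star g : GaussianInt)) < 1 := by
          constructor <;> intro h <;> nlinarith
        rw [e1, e2, h3]
    · have h1 := one_lt_normSq_sub_of_four_le ht hg
      have h2 := one_lt_normSq_sub_of_four_le ht' hg
      exact ⟨by linarith, ⟨fun _ => by linarith, fun _ => by linarith⟩⟩
  exact ⟨hu', ⟨inner, fun g => (main g).1⟩, fun g => (main g).2⟩

lemma iterate_eq_inv {z : ℂ} {n : ℕ} (h : gaussMap^[n] z ≠ 0) :
    gaussMap^[n] z = ((digit z n : ℂ) + gaussMap^[n + 1] z)⁻¹ := by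
  rw [← inv_iterate_eq h, inv_inv]

lemma iterate_mem_generic_of_succ {z : ℂ} {n : ℕ} (hz : z ∈ square) (h0 : gaussMap^[n] z ≠ 0)
    (h : gaussMap^[n + 1] z ∈ generic) : gaussMap^[n] z ∈ generic := by
  have e := iterate_eq_inv h0
  have hu : (digit z n : ℂ) + gaussMap^[n + 1] z ≠ 0 := by
    rw [← inv_iterate_eq h0]; exact inv_ne_zero h0
  have := (inv_add_mem_generic h h (fun _ => Iff.rfl) hu
    (by rw [← e]; exact iterate_gaussMap_mem_square hz n)).2.1
  rwa [← e] at this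

lemma iterate_mem_generic {z : ℂ} {n k : ℕ} (hz : z ∈ longExpansion n)
    (h : gaussMap^[n] z ∈ generic) (hk : k ≤ n) : gaussMap^[k] z ∈ generic := by
  induction n with
  | zero => rwa [Nat.le_zero.1 hk]
  | succ n ih =>
    rcases hk.eq_or_lt with rfl | hk
    · exact h
    · exact ih (longExpansion_anti n.le_succ hz)
        (iterate_mem_generic_of_succ hz.1 (hz.2 n (by omega)) h) (by omega)

lemma mem_seqCylinder_succ {a : ℕ → GaussianInt} {n : ℕ} {z : ℂ} :
    z ∈ seqCylinder a (n + 1) ↔ z ∈ seqCylinder a n ∧ gaussMap^[n] z ≠ 0 ∧ digit z n = a n := by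
  constructor
  · exact fun h => ⟨⟨h.1, fun k hk => h.2 k (by omega)⟩, h.2 n (by omega)⟩
  · rintro ⟨h1, h2⟩
    refine ⟨h1.1, fun k hk => ?_⟩
    rcases (Nat.lt_succ_iff.1 hk).eq_or_lt with rfl | hk
    · exact h2
    · exact h1.2 k hk

/-- The image of a cylinder under `T^n` is, up to non-generic points, a union of pieces into which
the unit circles around Gaussian integers cut the square. -/
lemma exists_mem_seqCylinder_of_sameSide {a : ℕ → GaussianInt} {n : ℕ} {z w : ℂ}
    (hz : z ∈ seqCylinder a n) (hg : gaussMap^[n] z ∈ generic) (hw : w ∈ generic)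
    (h : SameSide (gaussMap^[n] z) w) : ∃ z' ∈ seqCylinder a n, gaussMap^[n] z' = w := by
  induction n generalizing w with
  | zero => exact ⟨w, ⟨generic_subset_square hw, fun k hk => absurd hk (by omega)⟩, rfl⟩
  | succ n ih =>
    obtain ⟨h1, h0, hd⟩ := mem_seqCylinder_succ.1 hz
    have e := iterate_eq_inv h0
    have hu : (digit z n : ℂ) + gaussMap^[n + 1] z ≠ 0 := by
      rw [← inv_iterate_eq h0]; exact inv_ne_zero h0
    obtain ⟨hu', hgen, hside⟩ := inv_add_mem_generic hg hw h hu
      (by rw [← e]; exact iterate_gaussMap_mem_square hz.1 n)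
    rw [← e] at hside
    obtain ⟨z', hz', e'⟩ := ih h1 (iterate_mem_generic_of_succ hz.1 h0 hg) hgen hside
    refine ⟨z', mem_seqCylinder_succ.2 ⟨hz', ?_, ?_⟩, ?_⟩
    · rw [e']; exact inv_ne_zero hu'
    · rw [digit, e', inv_inv, nearest_add_of_mem_square _ (generic_subset_square hw), hd]
    · rw [Function.iterate_succ_apply', e', gaussMap_inv_add _ (generic_subset_square hw) hu']

lemma isOpen_openSquare :
    IsOpen {w : ℂ | (-(1 / 2) < w.re ∧ w.re < 1 / 2) ∧ (-(1 / 2) < w.im ∧ w.im < 1 / 2)} := by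
  simp only [ofPred_and]
  exact ((isOpen_lt continuous_const Complex.continuous_re).inter
    (isOpen_lt Complex.continuous_re continuous_const)).inter
    ((isOpen_lt continuous_const Complex.continuous_im).inter
    (isOpen_lt Complex.continuous_im continuous_const))

lemma square_mem_nhds {w : ℂ} (hw : w ∈ generic) : square ∈ 𝓝 w :=
  Filter.mem_of_superset (isOpen_openSquare.mem_nhds hw.1) fun _ h =>
    mem_square_iff.2 ⟨⟨h.1.1.le, h.1.2⟩, h.2.1.le, h.2.2⟩

/-- A generic image keeps 1/t off the lines where the nearest Gaussian integer jumps. -/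
lemma eventually_nearest_inv_eq {t : ℂ} (h0 : t ≠ 0) (h : gaussMap t ∈ generic) :
    ∀ᶠ t' in 𝓝 t, t' ≠ 0 ∧ nearest t'⁻¹ = nearest t⁻¹ := by
  have h1 : Tendsto (fun t' : ℂ => t'⁻¹ - (nearest t⁻¹ : ℂ)) (𝓝 t) (𝓝 (gaussMap t)) := by
    have : gaussMap t = t⁻¹ - (nearest t⁻¹ : ℂ) := by simp [gaussMap, h0]
    rw [this]
    exact (tendsto_inv₀ h0).sub_const _
  filter_upwards [h1.eventually (square_mem_nhds h), eventually_ne_nhds h0] with t' h2 h3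
  refine ⟨h3, ?_⟩
  have := nearest_add_of_mem_square (nearest t⁻¹) h2
  rwa [add_sub_cancel] at this

lemma continuousAt_gaussMap {t : ℂ} (h0 : t ≠ 0) (h : gaussMap t ∈ generic) :
    ContinuousAt gaussMap t := by
  have h1 : ContinuousAt (fun t' : ℂ => t'⁻¹ - (nearest t⁻¹ : ℂ)) t :=
    (continuousAt_inv₀ h0).sub continuousAt_const
  refine h1.congr ?_
  filter_upwards [eventually_nearest_inv_eq h0 h] with t' ht'
  simp [gaussMap, ht'.1, ht'.2]

/-- Both conclusions are proved together: continuity of T^n at z transports the local constancy of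
the next digit back to z. -/
lemma seqCylinder_mem_nhds {a : ℕ → GaussianInt} {n : ℕ} {z : ℂ} (hz : z ∈ seqCylinder a n)
    (hg : gaussMap^[n] z ∈ generic) : seqCylinder a n ∈ 𝓝 z ∧ ContinuousAt gaussMap^[n] z := by
  induction n with
  | zero =>
    refine ⟨Filter.mem_of_superset (square_mem_nhds hg) fun w hw =>
      ⟨hw, fun k hk => absurd hk (by omega)⟩, continuousAt_id⟩
  | succ n ih =>
    obtain ⟨h1, h0, hd⟩ := mem_seqCylinder_succ.1 hz
    obtain ⟨h2, h3⟩ := ih h1 (iterate_mem_generic_of_succ hz.1 h0 hg)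
    have hg' : gaussMap (gaussMap^[n] z) ∈ generic := by
      rwa [Function.iterate_succ_apply'] at hg
    constructor
    · filter_upwards [h2, h3.eventually (eventually_nearest_inv_eq h0 hg')] with w hw hw'
      exact mem_seqCylinder_succ.2 ⟨hw, hw'.1, hw'.2.trans hd⟩
    · rw [Function.iterate_succ']
      exact (continuousAt_gaussMap h0 hg').comp h3

/-- Exact, because |1/t − 1/t'| = |t − t'|/(|t||t'|) and equal digits cancel. With the bounds on
`expansion` it gives the Lipschitz constants 9‖q_n‖² and 16/‖q_n‖² below. -/
lemma dist_iterate_eq {a : ℕ → GaussianInt} {n : ℕ} {z z' : ℂ} (hz : z ∈ seqCylinder a n)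
    (hz' : z' ∈ seqCylinder a n) :
    dist (gaussMap^[n] z) (gaussMap^[n] z') = dist z z' * (expansion n z * expansion n z') := by
  induction n with
  | zero => simp [expansion]
  | succ n ih =>
    obtain ⟨h1, h0, hd⟩ := mem_seqCylinder_succ.1 hz
    obtain ⟨h1', h0', hd'⟩ := mem_seqCylinder_succ.1 hz'
    have e : gaussMap^[n + 1] z - gaussMap^[n + 1] z' =
        (gaussMap^[n] z)⁻¹ - (gaussMap^[n] z')⁻¹ := by
      rw [inv_iterate_eq h0, inv_iterate_eq h0', hd, hd']; ring
    rw [dist_eq_norm, e, ← dist_eq_norm, dist_inv_inv₀ h0 h0', ih h1 h1']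
    simp only [expansion, Finset.prod_range_succ]
    have := norm_ne_zero_iff.2 h0
    have := norm_ne_zero_iff.2 h0'
    field_simp

/-! ### Area of cylinders and of their images -/

/-- Two-dimensional Hausdorff measure on the plane. -/
def area : MeasureTheory.Measure ℂ :=
  MeasureTheory.Measure.hausdorffMeasure (Module.finrank ℝ ℂ : ℝ)

/-- Hausdorff measure bounds Lipschitz images of arbitrary sets, with no measurability or Jacobian.
The Haar property makes lines and circles null and open sets positive. -/
instance : area.IsAddHaarMeasure := MeasureTheory.isAddHaarMeasure_hausdorffMeasure

lemma area_image_le {f : ℂ → ℂ} {S : Set ℂ} {K : ℝ} (hK : 0 ≤ K)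
    (h : ∀ x ∈ S, ∀ y ∈ S, dist (f x) (f y) ≤ K * dist x y) :
    area (f '' S) ≤ ENNReal.ofReal K ^ 2 * area S := by
  have hf : LipschitzOnWith (NNReal.mk K hK) f S := LipschitzOnWith.of_dist_le_mul h
  have := hf.hausdorffMeasure_image_le (d := (Module.finrank ℝ ℂ : ℝ)) (by positivity)
  rw [ENNReal.rpow_natCast, Complex.finrank_real_complex] at this
  rw [area, ENNReal.ofReal, Real.toNNReal_of_nonneg hK]
  simpa [Complex.finrank_real_complex] using this

lemma area_le_image {f : ℂ → ℂ} {S : Set ℂ} {K : ℝ} (hK : 0 ≤ K)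
    (h : ∀ x ∈ S, ∀ y ∈ S, dist x y ≤ K * dist (f x) (f y)) :
    area S ≤ ENNReal.ofReal K ^ 2 * area (f '' S) := by
  have hinj : InjOn f S := fun x hx y hy e => dist_le_zero.1 (by simpa [e] using h x hx y hy)
  have e : Function.invFunOn f S '' (f '' S) = S := by
    rw [image_image]
    exact (image_congr fun x hx => hinj.leftInvOn_invFunOn hx).trans (image_id' S)
  conv_lhs => rw [← e]
  refine area_image_le hK ?_
  rintro _ ⟨x, hx, rfl⟩ _ ⟨y, hy, rfl⟩
  rw [hinj.leftInvOn_invFunOn hx, hinj.leftInvOn_invFunOn hy]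
  exact h x hx y hy

lemma area_re_eq (c : ℝ) : area {w : ℂ | w.re = c} = 0 := by
  have e : {w : ℂ | w.re = c} =
      (fun w => ((-c : ℝ) : ℂ) + w) ⁻¹' (LinearMap.ker Complex.reLm : Submodule ℝ ℂ) := by
    ext w; simp [neg_add_eq_zero, eq_comm]
  rw [e, MeasureTheory.measure_preimage_add]
  refine MeasureTheory.Measure.addHaar_submodule _ _ fun h => ?_
  have : (1 : ℂ) ∈ LinearMap.ker Complex.reLm := h ▸ Submodule.mem_top
  simp at this

lemma area_im_eq (c : ℝ) : area {w : ℂ | w.im = c} = 0 := by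
  have e : {w : ℂ | w.im = c} =
      (fun w => (⟨0, -c⟩ : ℂ) + w) ⁻¹' (LinearMap.ker Complex.imLm : Submodule ℝ ℂ) := by
    ext w; simp [neg_add_eq_zero, eq_comm]
  rw [e, MeasureTheory.measure_preimage_add]
  refine MeasureTheory.Measure.addHaar_submodule _ _ fun h => ?_
  have : Complex.I ∈ LinearMap.ker Complex.imLm := h ▸ Submodule.mem_top
  simp at this

instance : Countable GaussianInt :=
  Function.Injective.countable (f := fun g : GaussianInt => (g.re, g.im)) fun _ _ h =>
    Zsqrtd.ext (Prod.ext_iff.1 h).1 (Prod.ext_iff.1 h).2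

lemma area_square_diff_generic : area (square \ generic) = 0 := by
  have hsub : square \ generic ⊆ ({w : ℂ | w.re = -(1 / 2)} ∪ {w : ℂ | w.im = -(1 / 2)}) ∪
      ⋃ g : GaussianInt, Metric.sphere (g : ℂ) 1 := by
    rintro w ⟨hw, hn⟩
    rw [mem_square_iff] at hw
    by_contra h
    simp only [mem_union, mem_iUnion, mem_ofPred_eq, mem_sphere_iff_norm, not_or, not_exists] at h
    refine hn ⟨⟨⟨lt_of_le_of_ne hw.1.1 (Ne.symm h.1.1), hw.1.2⟩,
      lt_of_le_of_ne hw.2.1 (Ne.symm h.1.2), hw.2.2⟩, fun g hg => h.2 g ?_⟩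
    rw [Complex.normSq_eq_norm_sq] at hg
    exact (pow_eq_one_iff_of_nonneg (norm_nonneg _) two_ne_zero).1 hg
  refine MeasureTheory.measure_mono_null hsub ?_
  rw [MeasureTheory.measure_union_null_iff, MeasureTheory.measure_union_null_iff,
    MeasureTheory.measure_iUnion_null_iff]
  exact ⟨⟨area_re_eq _, area_im_eq _⟩, fun g => MeasureTheory.Measure.addHaar_sphere _ _ _⟩

lemma area_square_ne_top : area square ≠ ∞ := by
  refine ne_top_of_le_ne_top (MeasureTheory.measure_closedBall_lt_top (x := (0 : ℂ)) (r := 1)).ne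
    (MeasureTheory.measure_mono fun w hw => ?_)
  rw [mem_closedBall_zero_iff]
  linarith [norm_le_of_mem_square hw]

lemma area_square_pos : 0 < area square := by
  refine lt_of_lt_of_le (isOpen_openSquare.measure_pos area ⟨0, by norm_num⟩)
    (MeasureTheory.measure_mono fun w h => mem_square_iff.2 ⟨⟨h.1.1.le, h.1.2⟩, h.2.1.le, h.2.2⟩)

lemma nonempty_generic : generic.Nonempty := by
  by_contra h
  have h1 := area_square_diff_generic
  rw [not_nonempty_iff_eq_empty.1 h, sdiff_empty] at h1
  exact area_square_pos.ne' h1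

lemma denomSeq_digit_eq {a : ℕ → GaussianInt} {n : ℕ} {z : ℂ} (hz : z ∈ seqCylinder a n) :
    denomSeq (digit z) n = denomSeq a n :=
  denomSeq_congr fun k hk => (hz.2 k hk).2

lemma supNorm_denomSeq_pos {a : ℕ → GaussianInt} {n : ℕ} {z : ℂ} (hz : z ∈ seqCylinder a n) :
    1 ≤ supNorm (denomSeq a n : ℂ) := by
  rw [← denomSeq_digit_eq hz]
  exact one_le_supNorm (denomSeq_ne_zero (seqCylinder_subset_longExpansion a n hz))

lemma dist_iterate_le {a : ℕ → GaussianInt} {n : ℕ} {z z' : ℂ} (hz : z ∈ seqCylinder a n)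
    (hz' : z' ∈ seqCylinder a n) :
    dist (gaussMap^[n] z) (gaussMap^[n] z') ≤
      9 * supNorm (denomSeq a n : ℂ) ^ 2 * dist z z' := by
  rw [dist_iterate_eq hz hz']
  have h1 := expansion_le (seqCylinder_subset_longExpansion a n hz)
  have h2 := expansion_le (seqCylinder_subset_longExpansion a n hz')
  rw [denomSeq_digit_eq hz] at h1
  rw [denomSeq_digit_eq hz'] at h2
  have h3 := expansion_pos (seqCylinder_subset_longExpansion a n hz)
  have h4 := expansion_pos (seqCylinder_subset_longExpansion a n hz')
  calc dist z z' * (expansion n z * expansion n z')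
      ≤ dist z z' * ((3 * supNorm (denomSeq a n : ℂ)) * (3 * supNorm (denomSeq a n : ℂ))) := by
        gcongr
        linarith
    _ = _ := by ring

lemma dist_le_dist_iterate {a : ℕ → GaussianInt} {n : ℕ} {z z' : ℂ} (hz : z ∈ seqCylinder a n)
    (hz' : z' ∈ seqCylinder a n) :
    dist z z' ≤
      16 / supNorm (denomSeq a n : ℂ) ^ 2 * dist (gaussMap^[n] z) (gaussMap^[n] z') := by
  rw [dist_iterate_eq hz hz']
  have h1 := le_expansion (seqCylinder_subset_longExpansion a n hz)
  have h2 := le_expansion (seqCylinder_subset_longExpansion a n hz')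
  rw [denomSeq_digit_eq hz] at h1
  rw [denomSeq_digit_eq hz'] at h2
  have h3 := supNorm_denomSeq_pos hz
  set Q := supNorm (denomSeq a n : ℂ)
  have h0 := expansion_pos (seqCylinder_subset_longExpansion a n hz)
  calc dist z z' = 16 / Q ^ 2 * (dist z z' * ((Q / 4) * (Q / 4))) := by field_simp; norm_num
    _ ≤ _ := by gcongr

/-- The inverse of T^n on a cylinder is Lipschitz, so the null set of non-generic points pulls back
to a null set. -/
lemma area_inter_preimage_eq_zero (a : ℕ → GaussianInt) (n : ℕ) :
    area {z | z ∈ seqCylinder a n ∧ gaussMap^[n] z ∉ generic} = 0 := by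
  have h := area_le_image (f := gaussMap^[n])
    (S := {z | z ∈ seqCylinder a n ∧ gaussMap^[n] z ∉ generic})
    (K := 16 / supNorm (denomSeq a n : ℂ) ^ 2) (by positivity)
    fun x hx y hy => dist_le_dist_iterate hx.1 hy.1
  have h0 : area (gaussMap^[n] '' {z | z ∈ seqCylinder a n ∧ gaussMap^[n] z ∉ generic}) = 0 := by
    refine MeasureTheory.measure_mono_null ?_ area_square_diff_generic
    rintro _ ⟨z, hz, rfl⟩
    exact ⟨iterate_gaussMap_mem_square hz.1.1 n, hz.2⟩
  rw [h0, mul_zero] at h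
  exact le_zero_iff.1 h

/-- A cylinder is regular if and only if the orbit of one of its points is generic. -/
lemma interior_seqCylinder_nonempty_iff {a : ℕ → GaussianInt} {n : ℕ} :
    (interior (seqCylinder a n)).Nonempty ↔ ∃ z ∈ seqCylinder a n, gaussMap^[n] z ∈ generic := by
  constructor
  · intro h
    by_contra! hn
    have h1 := isOpen_interior.measure_pos area h
    have h2 : area (interior (seqCylinder a n)) = 0 :=
      MeasureTheory.measure_mono_null
        (fun z hz => show _ ∧ _ from ⟨interior_subset hz, hn z (interior_subset hz)⟩)
        (area_inter_preimage_eq_zero a n)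
    exact h1.ne' h2
  · rintro ⟨z, hz, hg⟩
    exact ⟨z, mem_interior_iff_mem_nhds.2 (seqCylinder_mem_nhds hz hg).1⟩

lemma area_seqCylinder_eq_zero {a : ℕ → GaussianInt} {n : ℕ}
    (h : ¬ (interior (seqCylinder a n)).Nonempty) : area (seqCylinder a n) = 0 := by
  rw [interior_seqCylinder_nonempty_iff] at h
  push Not at h
  exact MeasureTheory.measure_mono_null (fun z hz => show _ ∧ _ from ⟨hz, h z hz⟩)
    (area_inter_preimage_eq_zero a n)

lemma area_seqCylinder_le (a : ℕ → GaussianInt) (n : ℕ) :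
    area (seqCylinder a n) ≤
      ENNReal.ofReal (16 / supNorm (denomSeq a n : ℂ) ^ 2) ^ 2 * area square := by
  refine (area_le_image (f := gaussMap^[n]) (by positivity)
    fun x hx y hy => dist_le_dist_iterate hx hy).trans ?_
  gcongr
  rintro _ ⟨z, hz, rfl⟩
  exact iterate_gaussMap_mem_square hz.1 n

lemma area_image_seqCylinder_le (a : ℕ → GaussianInt) (n : ℕ) :
    area (gaussMap^[n] '' seqCylinder a n) ≤
      ENNReal.ofReal (9 * supNorm (denomSeq a n : ℂ) ^ 2) ^ 2 * area (seqCylinder a n) :=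
  area_image_le (by positivity) fun x hx y hy => dist_iterate_le hx hy

/-- The Gaussian integers whose unit discs meet the square. -/
def nearUnits : Finset GaussianInt :=
  (Finset.Icc (-1 : ℤ) 1 ×ˢ Finset.Icc (-1 : ℤ) 1).map
    ⟨fun p => ⟨p.1, p.2⟩, fun _ _ h => Prod.ext (Zsqrtd.ext_iff.1 h).1 (Zsqrtd.ext_iff.1 h).2⟩

lemma mem_nearUnits_of_normSq_le {w : ℂ} (hw : w ∈ square) {g : GaussianInt}
    (h : Complex.normSq (w - (g : ℂ)) ≤ 1) : g ∈ nearUnits := by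
  rw [mem_square_iff] at hw
  simp only [Complex.normSq_apply, Complex.sub_re, Complex.sub_im, re_coe, im_coe] at h
  have h1 : |w.re - g.re| ≤ 1 := abs_le_one_iff_mul_self_le_one.2
    (by nlinarith [mul_self_nonneg (w.im - g.im)])
  have h2 : |w.im - g.im| ≤ 1 := abs_le_one_iff_mul_self_le_one.2
    (by nlinarith [mul_self_nonneg (w.re - g.re)])
  rw [abs_le] at h1 h2
  have b1 : (g.re : ℝ) < ((2 : ℤ) : ℝ) := by push_cast; linarith
  have b2 : ((-2 : ℤ) : ℝ) < (g.re : ℝ) := by push_cast; linarith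
  have b3 : (g.im : ℝ) < ((2 : ℤ) : ℝ) := by push_cast; linarith
  have b4 : ((-2 : ℤ) : ℝ) < (g.im : ℝ) := by push_cast; linarith
  rw [Int.cast_lt] at b1 b2 b3 b4
  simp only [nearUnits, Finset.mem_map, Finset.mem_product, Finset.mem_Icc]
  exact ⟨(g.re, g.im), by simp only; omega, rfl⟩

open Classical in
/-- The Gaussian integers whose open unit disc contains `w`. -/
def discSet (w : ℂ) : Finset GaussianInt :=
  nearUnits.filter fun g => Complex.normSq (w - (g : ℂ)) < 1

lemma mem_discSet {w : ℂ} (hw : w ∈ square) {g : GaussianInt} :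
    g ∈ discSet w ↔ Complex.normSq (w - (g : ℂ)) < 1 := by
  simp only [discSet, Finset.mem_filter, and_iff_right_iff_imp]
  exact fun h => mem_nearUnits_of_normSq_le hw h.le

lemma sameSide_of_discSet_eq {w w' : ℂ} (hw : w ∈ square) (hw' : w' ∈ square)
    (h : discSet w = discSet w') : SameSide w w' := fun g => by
  rw [← mem_discSet hw, ← mem_discSet hw', h]

lemma setOf_discSet_mem_nhds {w : ℂ} (hw : w ∈ generic) :
    {w' | w' ∈ generic ∧ discSet w' = discSet w} ∈ 𝓝 w := by
  have hc : ∀ g : GaussianInt, Continuous fun w' : ℂ => Complex.normSq (w' - (g : ℂ)) :=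
    fun g => Complex.continuous_normSq.comp (continuous_id.sub continuous_const)
  have h1 : ∀ᶠ w' in 𝓝 w, ∀ g ∈ nearUnits, Complex.normSq (w' - (g : ℂ)) ≠ 1 ∧
      (Complex.normSq (w' - (g : ℂ)) < 1 ↔ Complex.normSq (w - (g : ℂ)) < 1) := by
    rw [Filter.eventually_all_finset]
    intro g _
    rcases lt_or_gt_of_ne (hw.2 g) with h | h
    · filter_upwards [(hc g).continuousAt.eventually_lt_const h] with w' hw'
      exact ⟨hw'.ne, iff_of_true hw' h⟩
    · filter_upwards [(hc g).continuousAt.eventually_const_lt h] with w' hw'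
      exact ⟨hw'.ne', iff_of_false hw'.not_gt h.not_gt⟩
  filter_upwards [h1, isOpen_openSquare.mem_nhds hw.1] with w' h2 h3
  have hsq : w' ∈ square := mem_square_iff.2 ⟨⟨h3.1.1.le, h3.1.2⟩, h3.2.1.le, h3.2.2⟩
  refine ⟨⟨h3, fun g hg => (h2 g (mem_nearUnits_of_normSq_le hsq hg.le)).1 hg⟩, ?_⟩
  classical
  exact Finset.filter_congr fun g hg => (h2 g hg).2

/-- The images of the regular cylinders have area bounded below. -/
lemma exists_le_area_image : ∃ c : ℝ≥0∞, 0 < c ∧ c ≠ ∞ ∧ ∀ (a : ℕ → GaussianInt) (n : ℕ),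
    (interior (seqCylinder a n)).Nonempty → c ≤ area (gaussMap^[n] '' seqCylinder a n) := by
  classical
  let E : Finset GaussianInt → Set ℂ := fun s => {w | w ∈ generic ∧ discSet w = s}
  let I : Finset (Finset GaussianInt) := nearUnits.powerset.filter fun s => (E s).Nonempty
  -- There are finitely many pieces, and each nonempty one is open around its points, hence of
  -- positive area. The minimum with 1 makes c finite even if the infimum ran over no piece.
  refine ⟨min 1 (I.inf fun s => area (E s)), ?_, by simp, fun a n h => (min_le_right _ _).trans ?_⟩
  · rw [lt_min_iff, Finset.lt_inf_iff (by simp)]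
    refine ⟨one_pos, fun s hs => ?_⟩
    obtain ⟨w, hw, rfl⟩ := (Finset.mem_filter.1 hs).2
    exact MeasureTheory.Measure.measure_pos_of_mem_nhds _ (setOf_discSet_mem_nhds hw)
  · obtain ⟨z, hz, hg⟩ := interior_seqCylinder_nonempty_iff.1 h
    refine (Finset.inf_le (b := discSet (gaussMap^[n] z)) (Finset.mem_filter.2
      ⟨Finset.mem_powerset.2 (Finset.filter_subset _ _), gaussMap^[n] z, hg, rfl⟩)).trans
      (MeasureTheory.measure_mono ?_)
    rintro w ⟨hw, hd⟩
    exact exists_mem_seqCylinder_of_sameSide hz hg hw (sameSide_of_discSet_eq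
      (generic_subset_square hg) (generic_subset_square hw) hd.symm)

/-! ### Regular words and the partition function -/

/-- The extension of a word by `0` to a sequence. -/
def pad {n : ℕ} (a : Fin n → GaussianInt) : ℕ → GaussianInt :=
  fun k => if h : k < n then a ⟨k, h⟩ else 0

lemma pad_apply {n : ℕ} (a : Fin n → GaussianInt) {k : ℕ} (h : k < n) : pad a k = a ⟨k, h⟩ :=
  dif_pos h

lemma denom_eq {n : ℕ} (a : Fin n → GaussianInt) : denom a = denomSeq (pad a) n := rfl

lemma cylinder_eq {n : ℕ} (a : Fin n → GaussianInt) : cylinder a = seqCylinder (pad a) n := by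
  ext z
  simp only [cylinder, seqCylinder, mem_ofPred_eq, and_congr_right_iff]
  refine fun _ => ⟨fun h k hk => ?_, fun h k => ?_⟩
  · rw [pad_apply a hk]; exact h ⟨k, hk⟩
  · have := h k k.2
    rwa [pad_apply a k.2] at this

/-- The form of regularity used from here on. The condition on the letters is automatic once the
cylinder contains a point. -/
lemma mem_regularWords_iff {n : ℕ} {a : Fin n → GaussianInt} :
    a ∈ regularWords n ↔ ∃ z ∈ seqCylinder (pad a) n, gaussMap^[n] z ∈ generic := by
  simp only [regularWords, mem_ofPred_eq, cylinder_eq, interior_seqCylinder_nonempty_iff,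
    and_iff_right_iff_imp]
  rintro ⟨z, hz, -⟩ k
  have h := hz.2 k k.2
  rw [pad_apply a k.2] at h
  rw [← h.2]
  exact nearest_inv_mem_digits (iterate_gaussMap_mem_square hz.1 k) h.1

lemma one_le_supNorm_denom {n : ℕ} {a : Fin n → GaussianInt} (ha : a ∈ regularWords n) :
    1 ≤ supNorm (denom a : ℂ) := by
  obtain ⟨z, hz, -⟩ := mem_regularWords_iff.1 ha
  exact supNorm_denomSeq_pos hz

lemma sqrt_two_pow_le_supNorm_denom {n : ℕ} {a : Fin n → GaussianInt} (ha : a ∈ regularWords n) :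
    √2 ^ n / 3 ≤ supNorm (denom a : ℂ) := by
  obtain ⟨z, hz, -⟩ := mem_regularWords_iff.1 ha
  have h1 := sqrt_two_pow_le_expansion (seqCylinder_subset_longExpansion _ n hz)
  have h2 := expansion_le (seqCylinder_subset_longExpansion _ n hz)
  rw [denomSeq_digit_eq hz] at h2
  rw [denom_eq]
  linarith

/-- The partition function `∑ ‖q_n(a)‖^{-2ρ}` over the regular words of length `n`. -/
def partitionFn (n : ℕ) (ρ : ℝ) : ℝ≥0∞ :=
  ∑' a : regularWords n, ENNReal.ofReal (supNorm (denom a.1 : ℂ) ^ (-(2 * ρ)))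

lemma g_eq (n : ℕ) (ρ : ℝ) {B : ℝ} (hB : 0 < B) :
    g n ρ B = ENNReal.ofReal ((5 * √2 / B ^ n) ^ ρ) * partitionFn n ρ := by
  rw [g, partitionFn, ← ENNReal.tsum_mul_left]
  refine tsum_congr fun a => ?_
  have h := one_le_supNorm_denom a.2
  rw [← ENNReal.ofReal_mul (by positivity), ← div_div, Real.div_rpow (by positivity)
    (by positivity), Real.rpow_neg (by linarith), ← div_eq_mul_inv,
    Real.rpow_mul (by linarith) 2 ρ, Real.rpow_two]

lemma partitionFn_anti (n : ℕ) {ρ ρ' : ℝ} (h : ρ ≤ ρ') : partitionFn n ρ' ≤ partitionFn n ρ := by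
  refine ENNReal.tsum_le_tsum fun a => ENNReal.ofReal_le_ofReal ?_
  exact Real.rpow_le_rpow_of_exponent_le (one_le_supNorm_denom a.2) (by linarith)

/-- Since ‖q_n‖ ≥ √2^n/3, lowering the exponent from 2 to ρ enlarges every term by at least this
factor. It is the source of the growth 2^{n(2−ρ)} in `le_pressure`. -/
lemma mul_partitionFn_two_le (n : ℕ) {ρ : ℝ} (h : ρ ≤ 2) :
    ENNReal.ofReal ((√2 ^ n / 3) ^ (2 * (2 - ρ))) * partitionFn n 2 ≤ partitionFn n ρ := by
  rw [partitionFn, partitionFn, ← ENNReal.tsum_mul_left]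
  refine ENNReal.tsum_le_tsum fun a => ?_
  have h1 := one_le_supNorm_denom a.2
  rw [← ENNReal.ofReal_mul (by positivity)]
  refine ENNReal.ofReal_le_ofReal ?_
  rw [show -(2 * ρ) = 2 * (2 - ρ) + -(2 * 2) by ring, Real.rpow_add (by linarith)]
  gcongr
  exact sqrt_two_pow_le_supNorm_denom a.2

lemma rpow_neg_two_mul_two {Q : ℝ} (hQ : 1 ≤ Q) : Q ^ (-(2 * 2 : ℝ)) = (Q ^ 4)⁻¹ := by
  rw [Real.rpow_neg (by linarith), show (2 * 2 : ℝ) = ((4 : ℕ) : ℝ) by norm_num,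
    Real.rpow_natCast]

lemma ofReal_div_sq_sq {Q : ℝ} (hQ : 1 ≤ Q) {c : ℝ} (hc : 0 ≤ c) :
    ENNReal.ofReal (c / Q ^ 2) ^ 2 =
      ENNReal.ofReal (c ^ 2) * ENNReal.ofReal (Q ^ (-(2 * 2 : ℝ))) := by
  rw [← ENNReal.ofReal_pow (by positivity), ← ENNReal.ofReal_mul (by positivity),
    rpow_neg_two_mul_two hQ, div_pow, div_eq_mul_inv, ← pow_mul]

lemma disjoint_cylinder {n : ℕ} {a b : Fin n → GaussianInt} (h : a ≠ b) :
    Disjoint (cylinder a) (cylinder b) := by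
  rw [Set.disjoint_left]
  intro z ha hb
  exact h (funext fun k => (ha.2 k).2.symm.trans (hb.2 k).2)

/-- Allows countable additivity to be applied to the open interiors, so measurability of cylinders
is not needed. -/
lemma area_cylinder_le_interior {n : ℕ} (a : Fin n → GaussianInt) :
    area (cylinder a) ≤ area (interior (cylinder a)) := by
  rw [cylinder_eq]
  have h : seqCylinder (pad a) n ⊆ interior (seqCylinder (pad a) n) ∪
      {z | z ∈ seqCylinder (pad a) n ∧ gaussMap^[n] z ∉ generic} := fun z hz => by
    by_cases hg : gaussMap^[n] z ∈ generic
    · exact Or.inl (mem_interior_iff_mem_nhds.2 (seqCylinder_mem_nhds hz hg).1)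
    · exact Or.inr ⟨hz, hg⟩
  refine (MeasureTheory.measure_mono h).trans ((MeasureTheory.measure_union_le _ _).trans ?_)
  rw [area_inter_preimage_eq_zero, add_zero]

lemma tsum_area_cylinder_le (n : ℕ) :
    ∑' a : regularWords n, area (cylinder a.1) ≤ area square := by
  have hd : Pairwise (Function.onFun Disjoint fun a : regularWords n => interior (cylinder a.1)) := by
    intro a b hab
    have h : a.1 ≠ b.1 := fun h => hab (Subtype.ext h)
    exact (disjoint_cylinder h).mono interior_subset interior_subset
  calc ∑' a : regularWords n, area (cylinder a.1)
      ≤ ∑' a : regularWords n, area (interior (cylinder a.1)) :=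
        ENNReal.tsum_le_tsum fun a => area_cylinder_le_interior a.1
    _ = area (⋃ a : regularWords n, interior (cylinder a.1)) :=
        (MeasureTheory.measure_iUnion hd fun a => isOpen_interior.measurableSet).symm
    _ ≤ area square := MeasureTheory.measure_mono
        (iUnion_subset fun a => interior_subset.trans fun z hz => hz.1)

/-- For a regular cylinder C, c ≤ area(T^n C) ≤ 81‖q_n‖⁴ area(C). Sum over the disjoint cylinders.
-/
lemma exists_partitionFn_two_le : ∃ C : ℝ≥0∞, C ≠ ∞ ∧ ∀ n, partitionFn n 2 ≤ C := by
  obtain ⟨c, hc, hc', h⟩ := exists_le_area_image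
  refine ⟨ENNReal.ofReal 81 * area square / c, ENNReal.div_ne_top
    (ENNReal.mul_ne_top ENNReal.ofReal_ne_top area_square_ne_top) hc.ne', fun n => ?_⟩
  rw [ENNReal.le_div_iff_mul_le (Or.inl hc.ne') (Or.inl hc')]
  refine le_trans ?_ (mul_le_mul_right (tsum_area_cylinder_le n) _)
  rw [partitionFn, ← ENNReal.tsum_mul_left, ← ENNReal.tsum_mul_right]
  refine ENNReal.tsum_le_tsum fun a => ?_
  have hQ := one_le_supNorm_denom a.2
  have h1 := h (pad a.1) n (by rw [← cylinder_eq]; exact a.2.2)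
  have h2 := h1.trans (area_image_seqCylinder_le (pad a.1) n)
  rw [← cylinder_eq, ← denom_eq] at h2
  set Q := supNorm (denom a.1 : ℂ)
  calc ENNReal.ofReal (Q ^ (-(2 * 2 : ℝ))) * c
      ≤ ENNReal.ofReal (Q ^ (-(2 * 2 : ℝ))) *
        (ENNReal.ofReal (9 * Q ^ 2) ^ 2 * area (cylinder a.1)) := by gcongr
    _ = ENNReal.ofReal 81 * area (cylinder a.1) := by
      rw [← mul_assoc, ← ENNReal.ofReal_pow (by positivity), ← ENNReal.ofReal_mul (by positivity)]
      congr 2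
      rw [rpow_neg_two_mul_two hQ]
      field_simp
      norm_num

lemma countable_iterate_eq_zero (n : ℕ) : {z : ℂ | gaussMap^[n] z = 0}.Countable := by
  induction n with
  | zero => simp
  | succ n ih =>
    have h1 : {w : ℂ | gaussMap w = 0}.Countable := by
      have : {w : ℂ | gaussMap w = 0} ⊆ {0} ∪ range fun a : GaussianInt => (a : ℂ)⁻¹ := by
        intro w hw
        by_cases h0 : w = 0
        · exact Or.inl h0
        · refine Or.inr ⟨nearest w⁻¹, ?_⟩
          have := inv_eq_nearest_add_gaussMap h0
          rw [show gaussMap w = 0 from hw, add_zero] at this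
          simp [← this]
      exact ((countable_singleton 0).union (countable_range _)).mono this
    have h2 : ∀ w : ℂ, {z : ℂ | gaussMap z = w}.Countable := by
      intro w
      have : {z : ℂ | gaussMap z = w} ⊆ {0} ∪ range fun a : GaussianInt => ((a : ℂ) + w)⁻¹ := by
        intro z hz
        by_cases h0 : z = 0
        · exact Or.inl h0
        · refine Or.inr ⟨nearest z⁻¹, ?_⟩
          have := inv_eq_nearest_add_gaussMap h0
          rw [show gaussMap z = w from hz] at this
          simp [← this]
      exact ((countable_singleton 0).union (countable_range _)).mono this
    have h3 : {z : ℂ | gaussMap^[n + 1] z = 0} =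
        ⋃ w ∈ {w : ℂ | gaussMap^[n] w = 0}, {z : ℂ | gaussMap z = w} := by
      ext z; simp
    rw [h3]
    exact ih.biUnion fun w _ => h2 w

/-- Irregular cylinders are null and countably many, and terminating expansions form a countable
set. So regular cylinders cover almost all of the square, each with area at most 16²‖q_n‖^{-4} times
that of the square. -/
lemma one_le_mul_partitionFn_two (n : ℕ) : 1 ≤ ENNReal.ofReal (16 ^ 2) * partitionFn n 2 := by
  have hcover : square ⊆ ((⋃ a : regularWords n, cylinder a.1) ∪
      ⋃ a : ((regularWords n)ᶜ : Set (Fin n → GaussianInt)), cylinder a.1) ∪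
      ⋃ k : ℕ, {z : ℂ | gaussMap^[k] z = 0} := by
    intro z hz
    by_cases h0 : ∃ k, gaussMap^[k] z = 0
    · exact Or.inr (mem_iUnion.2 h0)
    · push Not at h0
      refine Or.inl ?_
      have hmem : z ∈ cylinder fun k : Fin n => digit z k := ⟨hz, fun k => ⟨h0 k, rfl⟩⟩
      by_cases hr : (fun k : Fin n => digit z k) ∈ regularWords n
      · exact Or.inl (mem_iUnion.2 ⟨⟨_, hr⟩, hmem⟩)
      · exact Or.inr (mem_iUnion.2 ⟨⟨_, hr⟩, hmem⟩)
  have h1 : area (⋃ a : ((regularWords n)ᶜ : Set (Fin n → GaussianInt)), cylinder a.1) = 0 := by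
    rw [MeasureTheory.measure_iUnion_null_iff]
    rintro ⟨a, ha⟩
    rw [cylinder_eq]
    refine area_seqCylinder_eq_zero fun h => ha ?_
    exact mem_regularWords_iff.2 (interior_seqCylinder_nonempty_iff.1 h)
  have h2 : area (⋃ k : ℕ, {z : ℂ | gaussMap^[k] z = 0}) = 0 := by
    rw [MeasureTheory.measure_iUnion_null_iff]
    exact fun k => (countable_iterate_eq_zero k).measure_zero area
  have h3 : area square ≤ ENNReal.ofReal (16 ^ 2) * partitionFn n 2 * area square := by
    calc area square ≤ area (⋃ a : regularWords n, cylinder a.1) := by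
          refine (MeasureTheory.measure_mono hcover).trans ?_
          refine (MeasureTheory.measure_union_le _ _).trans ?_
          rw [h2, add_zero]
          refine (MeasureTheory.measure_union_le _ _).trans ?_
          rw [h1, add_zero]
      _ ≤ ∑' a : regularWords n, area (cylinder a.1) := MeasureTheory.measure_iUnion_le _
      _ ≤ ∑' a : regularWords n, ENNReal.ofReal (16 ^ 2) *
            ENNReal.ofReal (supNorm (denom a.1 : ℂ) ^ (-(2 * 2 : ℝ))) * area square := by
          refine ENNReal.tsum_le_tsum fun a => ?_
          rw [← ofReal_div_sq_sq (one_le_supNorm_denom a.2) (by norm_num), cylinder_eq]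
          exact area_seqCylinder_le _ _
      _ = _ := by rw [ENNReal.tsum_mul_right, ENNReal.tsum_mul_left, partitionFn]
  by_contra! hlt
  refine (lt_of_le_of_lt h3 ?_).false
  calc _ < 1 * area square :=
        (ENNReal.mul_lt_mul_iff_left area_square_pos.ne' area_square_ne_top).2 hlt
    _ = _ := one_mul _

/-! ### Submultiplicativity -/

lemma castAdd_mem_regularWords {n m : ℕ} {a : Fin (n + m) → GaussianInt} {z : ℂ}
    (hz : z ∈ seqCylinder (pad a) (n + m)) (hg : gaussMap^[n + m] z ∈ generic) :
    z ∈ seqCylinder (pad (a ∘ Fin.castAdd m)) n ∧ gaussMap^[n] z ∈ generic := by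
  refine ⟨⟨hz.1, fun k hk => ⟨(hz.2 k (by omega)).1, ?_⟩⟩,
    iterate_mem_generic (seqCylinder_subset_longExpansion _ _ hz) hg (by omega)⟩
  rw [(hz.2 k (by omega)).2, pad_apply _ (by omega), pad_apply _ hk]
  rfl

lemma natAdd_mem_regularWords {n m : ℕ} {a : Fin (n + m) → GaussianInt} {z : ℂ}
    (hz : z ∈ seqCylinder (pad a) (n + m)) (hg : gaussMap^[n + m] z ∈ generic) :
    gaussMap^[n] z ∈ seqCylinder (pad (a ∘ Fin.natAdd n)) m ∧
      gaussMap^[m] (gaussMap^[n] z) ∈ generic := by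
  have e : ∀ k, gaussMap^[k] (gaussMap^[n] z) = gaussMap^[n + k] z := fun k => by
    rw [← Function.iterate_add_apply, add_comm]
  refine ⟨⟨iterate_gaussMap_mem_square hz.1 n, fun k hk => ?_⟩, by rwa [e]⟩
  have h := hz.2 (n + k) (by omega)
  rw [digit, e]
  refine ⟨h.1, h.2.trans ?_⟩
  rw [pad_apply _ (by omega), pad_apply _ hk]
  rfl

/-- The expansion factor is multiplicative along the orbit of one point. Passing to denominators
costs 4 for each part and 3 for the whole word, and 48 = 4 · 4 · 3. -/
lemma supNorm_denom_mul_le {n m : ℕ} {a : Fin (n + m) → GaussianInt}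
    (ha : a ∈ regularWords (n + m)) :
    a ∘ Fin.castAdd m ∈ regularWords n ∧ a ∘ Fin.natAdd n ∈ regularWords m ∧
      supNorm (denom (a ∘ Fin.castAdd m) : ℂ) * supNorm (denom (a ∘ Fin.natAdd n) : ℂ) ≤
        48 * supNorm (denom a : ℂ) := by
  obtain ⟨z, hz, hg⟩ := mem_regularWords_iff.1 ha
  obtain ⟨h1, h2⟩ := castAdd_mem_regularWords hz hg
  obtain ⟨h3, h4⟩ := natAdd_mem_regularWords hz hg
  refine ⟨mem_regularWords_iff.2 ⟨_, h1, h2⟩, mem_regularWords_iff.2 ⟨_, h3, h4⟩, ?_⟩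
  have b1 := le_expansion (seqCylinder_subset_longExpansion _ _ h1)
  have b2 := le_expansion (seqCylinder_subset_longExpansion _ _ h3)
  have b3 := expansion_le (seqCylinder_subset_longExpansion _ _ hz)
  rw [denomSeq_digit_eq h1, ← denom_eq] at b1
  rw [denomSeq_digit_eq h3, ← denom_eq] at b2
  rw [denomSeq_digit_eq hz, ← denom_eq, expansion_add] at b3
  have p1 : 1 ≤ supNorm (denom (a ∘ Fin.castAdd m) : ℂ) := by
    rw [denom_eq]; exact supNorm_denomSeq_pos h1
  have p2 : 1 ≤ supNorm (denom (a ∘ Fin.natAdd n) : ℂ) := by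
    rw [denom_eq]; exact supNorm_denomSeq_pos h3
  have := mul_le_mul b1 b2 (by linarith) (by linarith)
  linarith

/-- Cutting a word after n letters is injective into pairs of regular words, which is enough for an
upper bound. -/
lemma partitionFn_add_le (n m : ℕ) {ρ : ℝ} (hρ : 0 ≤ ρ) :
    partitionFn (n + m) ρ ≤
      ENNReal.ofReal (48 ^ (2 * ρ)) * (partitionFn n ρ * partitionFn m ρ) := by
  let F : regularWords (n + m) → regularWords n × regularWords m := fun a =>
    (⟨_, (supNorm_denom_mul_le a.2).1⟩, ⟨_, (supNorm_denom_mul_le a.2).2.1⟩)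
  have hF : Function.Injective F := by
    intro a b h
    obtain ⟨h1, h2⟩ := Prod.ext_iff.1 h
    refine Subtype.ext (funext fun k => ?_)
    refine Fin.addCases (fun i => ?_) (fun i => ?_) k
    · exact congrFun (Subtype.ext_iff.1 h1) i
    · exact congrFun (Subtype.ext_iff.1 h2) i
  let f : regularWords n × regularWords m → ℝ≥0∞ := fun p =>
    ENNReal.ofReal (supNorm (denom p.1.1 : ℂ) ^ (-(2 * ρ))) *
      ENNReal.ofReal (supNorm (denom p.2.1 : ℂ) ^ (-(2 * ρ)))
  have hf : ∑' p, f p = partitionFn n ρ * partitionFn m ρ := by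
    rw [ENNReal.tsum_prod']
    simp only [f, ENNReal.tsum_mul_left, ENNReal.tsum_mul_right, partitionFn]
  rw [← hf, ← ENNReal.tsum_mul_left]
  refine le_trans (ENNReal.tsum_le_tsum fun a => ?_)
    (ENNReal.tsum_comp_le_tsum_of_injective hF
      fun p => ENNReal.ofReal (48 ^ (2 * ρ)) * f p)
  obtain ⟨h1, h2, h3⟩ := supNorm_denom_mul_le a.2
  have p0 := one_le_supNorm_denom a.2
  have p1 := one_le_supNorm_denom h1
  have p2 := one_le_supNorm_denom h2
  simp only [f, F]
  set Q := supNorm (denom a.1 : ℂ)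
  set Q1 := supNorm (denom (a.1 ∘ Fin.castAdd m) : ℂ)
  set Q2 := supNorm (denom (a.1 ∘ Fin.natAdd n) : ℂ)
  rw [← ENNReal.ofReal_mul (by positivity), ← ENNReal.ofReal_mul (by positivity)]
  refine ENNReal.ofReal_le_ofReal ?_
  have h4 : (Q1 * Q2) ^ (2 * ρ) ≤ (48 * Q) ^ (2 * ρ) :=
    Real.rpow_le_rpow (by positivity) h3 (by positivity)
  rw [Real.mul_rpow (by positivity) (by positivity),
    Real.mul_rpow (by positivity) (by positivity)] at h4
  have q0 : 0 < Q ^ (2 * ρ) := by positivity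
  have q1 : 0 < Q1 ^ (2 * ρ) := by positivity
  have q2 : 0 < Q2 ^ (2 * ρ) := by positivity
  rw [Real.rpow_neg (by positivity), Real.rpow_neg (by positivity), Real.rpow_neg (by positivity),
    ← mul_inv, ← div_eq_mul_inv, le_div_iff₀ (by positivity), inv_mul_le_iff₀ q0]
  linarith

/-! ### Convergence for ρ > 1 and divergence for ρ ≤ 1 -/

lemma summable_supNorm_rpow {ρ : ℝ} (hρ : 1 < ρ) :
    Summable fun g : GaussianInt => supNorm (g : ℂ) ^ (-(2 * ρ)) := by
  have h := EisensteinSeries.summable_one_div_norm_rpow (k := 2 * ρ) (by linarith)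
  have hinj : Function.Injective fun g : GaussianInt => ![g.re, g.im] := fun g g' hg =>
    Zsqrtd.ext (congrFun hg 0) (congrFun hg 1)
  refine (h.comp_injective hinj).congr fun g => ?_
  simp only [Function.comp_apply, EisensteinSeries.norm_eq_max_natAbs, supNorm, re_coe, im_coe,
    Matrix.cons_val_zero, Matrix.cons_val_one, Nat.cast_max, Nat.cast_natAbs, Int.cast_abs]

lemma partitionFn_one_ne_top {ρ : ℝ} (hρ : 1 < ρ) : partitionFn 1 ρ ≠ ∞ := by
  have hinj : Function.Injective fun a : regularWords 1 => a.1 0 := fun a b h =>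
    Subtype.ext (funext fun k => by rw [Subsingleton.elim k 0]; exact h)
  refine ne_top_of_le_ne_top (summable_supNorm_rpow hρ).tsum_ofReal_ne_top ?_
  refine le_trans (ENNReal.tsum_le_tsum fun a => ?_)
    (ENNReal.tsum_comp_le_tsum_of_injective hinj _)
  exact le_rfl

lemma partitionFn_succ_ne_top (n : ℕ) {ρ : ℝ} (hρ : 1 < ρ) : partitionFn (n + 1) ρ ≠ ∞ := by
  induction n with
  | zero => exact partitionFn_one_ne_top hρ
  | succ n ih =>
    exact ne_top_of_le_ne_top (ENNReal.mul_ne_top ENNReal.ofReal_ne_top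
      (ENNReal.mul_ne_top ih (partitionFn_one_ne_top hρ)))
      (partitionFn_add_le (n + 1) 1 (by linarith))

/-- Words with large letters have full cylinders. -/
lemma exists_mem_seqCylinder_of_large {a : ℕ → GaussianInt} {n : ℕ}
    (ha : ∀ k < n, 9 ≤ (a k).re ^ 2 + (a k).im ^ 2) {w : ℂ} (hw : w ∈ square) :
    ∃ z ∈ seqCylinder a n, gaussMap^[n] z = w := by
  induction n generalizing w with
  | zero => exact ⟨w, ⟨hw, fun k hk => absurd hk (by omega)⟩, rfl⟩
  | succ n ih =>
    -- From |a_n| ≥ 3 and |w| ≤ 3/4 follows |a_n + w| > 2, so the inverse stays in the square for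
    -- every w.
    have hn : (3 : ℝ) ≤ ‖(a n : ℂ)‖ := by
      rw [Complex.norm_def, normSq_toComplex]
      refine Real.le_sqrt_of_sq_le ?_
      rw [show (3 : ℝ) ^ 2 = ((9 : ℤ) : ℝ) by norm_num]
      exact Int.cast_le.2 (ha n (by omega))
    have hu : 2 < ‖(a n : ℂ) + w‖ := by
      have := norm_sub_norm_le (a n : ℂ) (-w)
      rw [norm_neg, sub_neg_eq_add] at this
      linarith [norm_le_of_mem_square hw]
    have hu0 : (a n : ℂ) + w ≠ 0 := fun h => by rw [h, norm_zero] at hu; linarith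
    have ht : ((a n : ℂ) + w)⁻¹ ∈ square := by
      have h1 : ‖((a n : ℂ) + w)⁻¹‖ < 1 / 2 := by
        rw [norm_inv, one_div]; exact inv_strictAnti₀ two_pos hu
      have h2 := abs_lt.1 ((Complex.abs_re_le_norm _).trans_lt h1)
      have h3 := abs_lt.1 ((Complex.abs_im_le_norm _).trans_lt h1)
      exact mem_square_iff.2 ⟨⟨h2.1.le, h2.2⟩, h3.1.le, h3.2⟩
    obtain ⟨z, hz, e⟩ := ih (fun k hk => ha k (by omega)) ht
    refine ⟨z, mem_seqCylinder_succ.2 ⟨hz, ?_, ?_⟩, ?_⟩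
    · rw [e]; exact inv_ne_zero hu0
    · rw [digit, e, inv_inv, nearest_add_of_mem_square _ hw]
    · rw [Function.iterate_succ_apply', e, gaussMap_inv_add _ hw hu0]

/-- The word `3, …, 3, g` of length `n + 1`. -/
def threesThen (n : ℕ) (g : GaussianInt) : Fin (n + 1) → GaussianInt :=
  fun k => if (k : ℕ) = n then g else 3

lemma threesThen_mem_regularWords (n : ℕ) {g : GaussianInt} (hg : 9 ≤ g.re ^ 2 + g.im ^ 2) :
    threesThen n g ∈ regularWords (n + 1) := by
  obtain ⟨w, hw⟩ := nonempty_generic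
  obtain ⟨z, hz, e⟩ := exists_mem_seqCylinder_of_large (a := pad (threesThen n g)) (n := n + 1)
    (fun k hk => by
      rw [pad_apply _ hk, threesThen]
      split_ifs
      · exact hg
      · exact (show (9 : ℤ) ≤ 3 ^ 2 + 0 ^ 2 by norm_num)) (generic_subset_square hw)
  exact mem_regularWords_iff.2 ⟨z, hz, by rwa [e]⟩

/-- With the prefix fixed, the denominator is affine in the last letter g. -/
lemma exists_supNorm_denom_threesThen_le (n : ℕ) : ∃ K : ℝ, 1 ≤ K ∧ ∀ g : GaussianInt,
    1 ≤ ‖(g : ℂ)‖ → supNorm (denom (threesThen n g) : ℂ) ≤ K * ‖(g : ℂ)‖ := by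
  refine ⟨1 + ‖(denomSeq (fun _ => 3) n : ℂ)‖ + ‖(denomPrev (fun _ => 3) n : ℂ)‖,
    by linarith [norm_nonneg (denomSeq (fun _ => 3) n : ℂ),
      norm_nonneg (denomPrev (fun _ => 3) n : ℂ)], fun g hg => ?_⟩
  have h := denomSeq_congr_aux (a := pad (threesThen n g)) (b := fun _ => 3) n fun k hk => by
    rw [pad_apply _ (by omega), threesThen, if_neg (by simp only; omega)]
  have hlast : pad (threesThen n g) n = g := by
    rw [pad_apply _ (by omega), threesThen, if_pos rfl]
  refine (supNorm_le_norm _).trans ?_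
  rw [denom_eq, denomSeq_succ, h.1, h.2, hlast, GaussianInt.toComplex_add,
    GaussianInt.toComplex_mul]
  refine (norm_add_le _ _).trans ?_
  rw [norm_mul]
  nlinarith [norm_nonneg (denomSeq (fun _ => 3) n : ℂ), norm_nonneg (denomPrev (fun _ => 3) n : ℂ)]

lemma tsum_ofReal_inv_add_three : ∑' x : ℕ, ENNReal.ofReal (1 / ((x : ℝ) + 3)) = ∞ := by
  by_contra h
  have h1 : Summable fun x : ℕ => 1 / ((x : ℝ) + 3) := by
    have := ENNReal.summable_toReal h
    exact this.congr fun x => ENNReal.toReal_ofReal (by positivity)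
  have h2 : Summable fun x : ℕ => 1 / (((x + 3 : ℕ) : ℝ)) := by
    refine h1.congr fun x => by push_cast; ring
  exact Real.not_summable_one_div_natCast ((summable_nat_add_iff 3).1 h2)

lemma partitionFn_eq_top (n : ℕ) {ρ : ℝ} (hρ : ρ ≤ 1) : partitionFn (n + 1) ρ = ∞ := by
  obtain ⟨K, hK, hle⟩ := exists_supNorm_denom_threesThen_le n
  -- The last letter runs over a sector having x + 3 points with real part x + 3. Each contributes
  -- at least a constant times (x + 3)^{-2}, so the rows sum to a harmonic series.
  let D : (Σ x : ℕ, Fin (x + 3)) → GaussianInt := fun p => ⟨(p.1 + 3 : ℕ), (p.2 : ℕ)⟩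
  have hreg : ∀ p, threesThen n (D p) ∈ regularWords (n + 1) := fun p => by
    refine threesThen_mem_regularWords n ?_
    simp only [D]
    push_cast
    nlinarith [sq_nonneg ((p.2 : ℕ) : ℤ), sq_nonneg (p.1 : ℤ), Int.natCast_nonneg p.1]
  let F : (Σ x : ℕ, Fin (x + 3)) → regularWords (n + 1) := fun p => ⟨_, hreg p⟩
  have hF : Function.Injective F := by
    rintro ⟨x, y⟩ ⟨x', y'⟩ h
    have h1 := congrFun (Subtype.ext_iff.1 h) (Fin.last n)
    simp only [F, threesThen, Fin.val_last, if_true, D, Zsqrtd.ext_iff, Nat.cast_inj,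
      add_left_inj] at h1
    obtain ⟨rfl, h2⟩ := h1
    rw [Fin.ext h2]
  have hterm : ∀ p : Σ x : ℕ, Fin (x + 3),
      ENNReal.ofReal (1 / (4 * K ^ 2 * ((p.1 : ℝ) + 3) ^ 2)) ≤
        ENNReal.ofReal (supNorm (denom (F p).1 : ℂ) ^ (-(2 * ρ))) := by
    intro p
    have hp : ((p.2 : ℕ) : ℝ) ≤ (p.1 : ℝ) + 3 := by
      have := p.2.2
      exact_mod_cast this.le
    have hx : ‖(D p : ℂ)‖ ≤ 2 * ((p.1 : ℝ) + 3) := by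
      refine (Complex.norm_le_abs_re_add_abs_im _).trans ?_
      rw [re_coe, im_coe]
      simp only [D]
      push_cast
      rw [abs_of_nonneg (by positivity), abs_of_nonneg (by positivity)]
      linarith
    have hx1 : 1 ≤ ‖(D p : ℂ)‖ := by
      refine le_trans ?_ (Complex.abs_re_le_norm _)
      rw [re_coe]
      simp only [D]
      push_cast
      rw [abs_of_nonneg (by positivity)]
      linarith [Nat.cast_nonneg (α := ℝ) p.1]
    have hQ : supNorm (denom (F p).1 : ℂ) ≤ K * (2 * ((p.1 : ℝ) + 3)) :=
      (hle (D p) hx1).trans (by gcongr)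
    have hQ1 := one_le_supNorm_denom (F p).2
    refine ENNReal.ofReal_le_ofReal ?_
    calc 1 / (4 * K ^ 2 * ((p.1 : ℝ) + 3) ^ 2)
        = 1 / (K * (2 * ((p.1 : ℝ) + 3))) ^ 2 := by ring
      _ ≤ 1 / supNorm (denom (F p).1 : ℂ) ^ 2 := by gcongr
      _ = supNorm (denom (F p).1 : ℂ) ^ (-2 : ℝ) := by
        rw [Real.rpow_neg (by linarith), one_div, Real.rpow_two]
      _ ≤ _ := Real.rpow_le_rpow_of_exponent_le hQ1 (by linarith)
  rw [eq_top_iff]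
  calc (∞ : ℝ≥0∞) = ENNReal.ofReal (1 / (4 * K ^ 2)) *
        ∑' x : ℕ, ENNReal.ofReal (1 / ((x : ℝ) + 3)) := by
        rw [tsum_ofReal_inv_add_three, ENNReal.mul_top]
        exact (ENNReal.ofReal_pos.2 (by positivity)).ne'
    _ = ∑' p : Σ x : ℕ, Fin (x + 3), ENNReal.ofReal (1 / (4 * K ^ 2 * ((p.1 : ℝ) + 3) ^ 2)) := by
        rw [ENNReal.tsum_sigma', ← ENNReal.tsum_mul_left]
        refine tsum_congr fun x => ?_
        dsimp only
        rw [tsum_fintype, Finset.sum_const, Finset.card_univ, Fintype.card_fin, nsmul_eq_mul,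
          ← ENNReal.ofReal_mul (by positivity), ← ENNReal.ofReal_natCast, ← ENNReal.ofReal_mul (by positivity)]
        congr 1
        push_cast
        field_simp
    _ ≤ ∑' p, ENNReal.ofReal (supNorm (denom (F p).1 : ℂ) ^ (-(2 * ρ))) :=
        ENNReal.tsum_le_tsum hterm
    _ ≤ partitionFn (n + 1) ρ := ENNReal.tsum_comp_le_tsum_of_injective hF
        fun a : regularWords (n + 1) => ENNReal.ofReal (supNorm (denom a.1 : ℂ) ^ (-(2 * ρ)))

lemma partitionFn_ne_top (n : ℕ) {ρ : ℝ} (hρ : 1 < ρ) : partitionFn n ρ ≠ ∞ := by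
  cases n with
  | zero =>
    have := Fintype.ofFinite (regularWords 0)
    rw [partitionFn, tsum_fintype]
    exact ENNReal.sum_ne_top.2 fun _ _ => ENNReal.ofReal_ne_top
  | succ n => exact partitionFn_succ_ne_top n hρ

/-! ### The pressure -/

lemma one_div_le_partitionFn_two (n : ℕ) : 1 / 256 ≤ (partitionFn n 2).toReal := by
  have h := ENNReal.toReal_mono (ENNReal.mul_ne_top ENNReal.ofReal_ne_top
    (partitionFn_ne_top n one_lt_two)) (one_le_mul_partitionFn_two n)
  rw [ENNReal.toReal_mul, ENNReal.toReal_ofReal (by norm_num), ENNReal.toReal_one] at h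
  linarith

lemma one_div_le_partitionFn (n : ℕ) {ρ : ℝ} (hρ : 1 < ρ) (hρ' : ρ ≤ 2) :
    1 / 256 ≤ (partitionFn n ρ).toReal :=
  (one_div_le_partitionFn_two n).trans
    (ENNReal.toReal_mono (partitionFn_ne_top n hρ) (partitionFn_anti n hρ'))

lemma partitionFn_pos (n : ℕ) {ρ : ℝ} (hρ : 1 < ρ) (hρ' : ρ ≤ 2) :
    0 < (partitionFn n ρ).toReal :=
  lt_of_lt_of_le (by norm_num) (one_div_le_partitionFn n hρ hρ')

lemma neg_log_le_log_partitionFn (n : ℕ) {ρ : ℝ} (hρ : 1 < ρ) (hρ' : ρ ≤ 2) :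
    -Real.log 256 ≤ Real.log (partitionFn n ρ).toReal := by
  rw [← Real.log_inv, ← one_div]
  exact Real.log_le_log (by norm_num) (one_div_le_partitionFn n hρ hρ')

/-- The pressure `lim (1/n) log ∑ ‖q_n(a)‖^{-2ρ}`. -/
def pressure (ρ : ℝ) : ℝ :=
  limUnder atTop fun n : ℕ => Real.log (partitionFn n ρ).toReal / n

/-- Fekete's lemma for c + log Z_n, where c absorbs the constant of submultiplicativity. Boundedness
below comes from Z_n(ρ) ≥ Z_n(2) ≥ 1/256. -/
lemma tendsto_pressure {ρ : ℝ} (hρ : 1 < ρ) (hρ' : ρ ≤ 2) :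
    Tendsto (fun n : ℕ => Real.log (partitionFn n ρ).toReal / n) atTop (𝓝 (pressure ρ)) := by
  refine tendsto_nhds_limUnder ?_
  set c := Real.log (48 ^ (2 * ρ)) with hc
  have hc0 : 0 ≤ c := Real.log_nonneg (Real.one_le_rpow (by norm_num) (by linarith))
  let u : ℕ → ℝ := fun n => c + Real.log (partitionFn n ρ).toReal
  have hsub : Subadditive u := by
    intro m n
    have h := ENNReal.toReal_mono (ENNReal.mul_ne_top ENNReal.ofReal_ne_top
      (ENNReal.mul_ne_top (partitionFn_ne_top m hρ) (partitionFn_ne_top n hρ)))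
      (partitionFn_add_le m n (by linarith : 0 ≤ ρ))
    rw [ENNReal.toReal_mul, ENNReal.toReal_mul, ENNReal.toReal_ofReal (by positivity)] at h
    have h1 := Real.log_le_log (partitionFn_pos _ hρ hρ') h
    have pm := partitionFn_pos m hρ hρ'
    have pn := partitionFn_pos n hρ hρ'
    rw [Real.log_mul (by positivity) (by positivity),
      Real.log_mul pm.ne' pn.ne'] at h1
    simp only [u]
    linarith
  have hbdd : BddBelow (range fun n => u n / n) := by
    refine ⟨-Real.log 256, ?_⟩
    rintro _ ⟨n, rfl⟩
    have h256 : 0 ≤ Real.log 256 := Real.log_nonneg (by norm_num)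
    simp only
    -- At n = 0 the quotient is 0 by convention, so the lower bound has to be nonpositive.
    rcases Nat.eq_zero_or_pos n with rfl | hn
    · simp [h256]
    · have hn1 : (1 : ℝ) ≤ n := by exact_mod_cast hn
      have := neg_log_le_log_partitionFn n hρ hρ'
      rw [le_div_iff₀ (by linarith)]
      simp only [u]
      nlinarith
  refine ⟨hsub.lim, ?_⟩
  have h0 : Tendsto (fun n : ℕ => c / (n : ℝ)) atTop (𝓝 0) := tendsto_const_div_atTop_nhds_zero_nat c
  have h1 := (hsub.tendsto_lim hbdd).sub h0
  rw [sub_zero] at h1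
  refine h1.congr fun n => ?_
  simp only [u]
  ring

lemma pressure_anti {ρ ρ' : ℝ} (hρ : 1 < ρ) (h : ρ ≤ ρ') (hρ' : ρ' ≤ 2) :
    pressure ρ' ≤ pressure ρ := by
  refine le_of_tendsto_of_tendsto' (tendsto_pressure (hρ.trans_le h) hρ')
    (tendsto_pressure hρ (h.trans hρ')) fun n => ?_
  gcongr
  · exact partitionFn_pos n (hρ.trans_le h) hρ'
  · exact partitionFn_ne_top n hρ
  · exact partitionFn_anti n h

lemma pressure_two_nonpos : pressure 2 ≤ 0 := by
  obtain ⟨C, hC, h⟩ := exists_partitionFn_two_le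
  refine le_of_tendsto_of_tendsto' (tendsto_pressure one_lt_two le_rfl)
    (tendsto_const_div_atTop_nhds_zero_nat (Real.log C.toReal)) fun n => ?_
  have := partitionFn_pos n one_lt_two le_rfl
  gcongr
  exact h n

lemma le_pressure {ρ : ℝ} (hρ : 1 < ρ) (hρ' : ρ ≤ 2) : (2 - ρ) * Real.log 2 ≤ pressure ρ := by
  set c := -(2 * (2 - ρ) * Real.log 3 + Real.log 256) with hc
  have h0 : Tendsto (fun n : ℕ => (2 - ρ) * Real.log 2 + c / (n : ℝ)) atTop
      (𝓝 ((2 - ρ) * Real.log 2)) := by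
    simpa using (tendsto_const_div_atTop_nhds_zero_nat c).const_add ((2 - ρ) * Real.log 2)
  refine le_of_tendsto_of_tendsto h0 (tendsto_pressure hρ hρ') ?_
  filter_upwards [eventually_gt_atTop 0] with n hn
  have hn0 : (0 : ℝ) < n := by exact_mod_cast hn
  have h := ENNReal.toReal_mono (partitionFn_ne_top n hρ) (mul_partitionFn_two_le n hρ')
  rw [ENNReal.toReal_mul, ENNReal.toReal_ofReal (by positivity)] at h
  have hp := partitionFn_pos n one_lt_two le_rfl
  have h1 := Real.log_le_log (by positivity) h
  rw [Real.log_mul (by positivity) hp.ne', Real.log_rpow (by positivity),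
    Real.log_div (by positivity) (by norm_num), Real.log_pow, Real.log_sqrt (by norm_num)] at h1
  have h2 := neg_log_le_log_partitionFn n one_lt_two le_rfl
  rw [le_div_iff₀ hn0, add_mul, div_mul_cancel₀ _ hn0.ne']
  linarith

lemma tendsto_log_g {ρ B : ℝ} (hρ : 1 < ρ) (hρ' : ρ ≤ 2) (hB : 1 < B) :
    ∃ e : ℕ → ℝ, Tendsto e atTop (𝓝 (pressure ρ - ρ * Real.log B)) ∧
      ∀ n, 0 < n → g n ρ B = ENNReal.ofReal (Real.exp (n * e n)) := by
  have hB0 : 0 < B := by linarith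
  refine ⟨fun n => Real.log (partitionFn n ρ).toReal / n - ρ * Real.log B +
    ρ * Real.log (5 * √2) / n, ?_, fun n hn => ?_⟩
  · simpa using ((tendsto_pressure hρ hρ').sub_const (ρ * Real.log B)).add
      (tendsto_const_div_atTop_nhds_zero_nat (ρ * Real.log (5 * √2)))
  · have hn0 : (n : ℝ) ≠ 0 := by exact_mod_cast hn.ne'
    have hp := partitionFn_pos n hρ hρ'
    rw [g_eq n ρ hB0, ← ENNReal.ofReal_toReal (partitionFn_ne_top n hρ),
      ← ENNReal.ofReal_mul (by positivity)]
    congr 1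
    rw [Real.rpow_def_of_pos (by positivity), Real.log_div (by positivity) (by positivity),
      Real.log_pow]
    conv_lhs => rw [← Real.exp_log hp, ← Real.exp_add]
    congr 1
    field_simp
    ring

lemma eventually_g_le_one {ρ B : ℝ} (hρ : 1 < ρ) (hρ' : ρ ≤ 2) (hB : 1 < B)
    (h : pressure ρ < ρ * Real.log B) : ∀ᶠ n in atTop, g n ρ B ≤ 1 := by
  obtain ⟨e, he, hg⟩ := tendsto_log_g hρ hρ' hB
  filter_upwards [he.eventually_lt_const (sub_neg.2 h), eventually_gt_atTop 0] with n hn hn0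
  rw [hg n hn0, ENNReal.ofReal_le_one, Real.exp_le_one_iff]
  exact mul_nonpos_of_nonneg_of_nonpos n.cast_nonneg hn.le

lemma eventually_one_lt_g {ρ B : ℝ} (hρ : 1 < ρ) (hρ' : ρ ≤ 2) (hB : 1 < B)
    (h : ρ * Real.log B < pressure ρ) : ∀ᶠ n in atTop, 1 < g n ρ B := by
  obtain ⟨e, he, hg⟩ := tendsto_log_g hρ hρ' hB
  filter_upwards [he.eventually_const_lt (sub_pos.2 h), eventually_gt_atTop 0] with n hn hn0
  have hn0' : (0 : ℝ) < n := by exact_mod_cast hn0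
  rw [hg n hn0, ENNReal.one_lt_ofReal, Real.one_lt_exp_iff]
  positivity

/-- Once B^n ≥ 5√2 the prefactor decreases in ρ as well. One exponent with g_n > 1 then settles all
smaller ones. -/
lemma eventually_g_anti {B : ℝ} (hB : 1 < B) :
    ∀ᶠ n in atTop, ∀ ρ ρ' : ℝ, ρ ≤ ρ' → g n ρ' B ≤ g n ρ B := by
  filter_upwards [(tendsto_pow_atTop_atTop_of_one_lt hB).eventually_ge_atTop (5 * √2)]
    with n hn ρ ρ' h
  have hB0 : 0 < B := by linarith
  rw [g_eq n ρ hB0, g_eq n ρ' hB0]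
  have h1 := partitionFn_anti n h
  gcongr ENNReal.ofReal ?_ * ?_
  exact Real.rpow_le_rpow_of_exponent_ge (by positivity)
    ((div_le_one (by positivity)).2 hn) h

/-! ### The critical exponent as the limit of the levels -/

/-- The zero of `ρ ↦ P(ρ) - ρ log B`, or `1` if there is none. -/
def criticalExponent (B : ℝ) : ℝ :=
  sSup (insert 1 {ρ : ℝ | 1 < ρ ∧ ρ ≤ 2 ∧ ρ * Real.log B ≤ pressure ρ})

lemma two_mem_upperBounds (B : ℝ) :
    2 ∈ upperBounds (insert 1 {ρ : ℝ | 1 < ρ ∧ ρ ≤ 2 ∧ ρ * Real.log B ≤ pressure ρ}) := by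
  rintro ρ (rfl | h)
  · norm_num
  · exact h.2.1

lemma one_le_criticalExponent (B : ℝ) : 1 ≤ criticalExponent B :=
  le_csSup ⟨2, two_mem_upperBounds B⟩ (mem_insert _ _)

lemma criticalExponent_le_two (B : ℝ) : criticalExponent B ≤ 2 :=
  csSup_le (insert_nonempty _ _) (two_mem_upperBounds B)

lemma le_criticalExponent {ρ B : ℝ} (hρ : 1 < ρ) (hρ' : ρ ≤ 2)
    (h : ρ * Real.log B ≤ pressure ρ) : ρ ≤ criticalExponent B :=
  le_csSup ⟨2, two_mem_upperBounds B⟩ (Or.inr ⟨hρ, hρ', h⟩)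

/-- P is nonincreasing and log B > 0, so P(ρ) − ρ log B is strictly decreasing up to 2: one negative
value excludes all larger exponents. Continuity of P is not needed. -/
lemma criticalExponent_le {ρ B : ℝ} (hρ : 1 < ρ) (hB : 1 < B)
    (h : pressure ρ < ρ * Real.log B) : criticalExponent B ≤ ρ := by
  refine csSup_le (insert_nonempty _ _) ?_
  rintro ρ' (rfl | h')
  · exact hρ.le
  · by_contra! hlt
    have h1 := pressure_anti hρ hlt.le h'.2.1
    have h2 := mul_lt_mul_of_pos_right hlt (Real.log_pos hB)
    linarith [h'.2.2]

lemma pressure_lt_of_criticalExponent_lt {ρ B : ℝ} (h : criticalExponent B < ρ)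
    (hρ' : ρ ≤ 2) : pressure ρ < ρ * Real.log B := by
  by_contra! hn
  exact (le_criticalExponent ((one_le_criticalExponent B).trans_lt h) hρ' hn).not_gt h

lemma lt_pressure_of_lt_criticalExponent {ρ B : ℝ} (hρ : 1 < ρ) (hB : 1 < B)
    (h : ρ < criticalExponent B) : ρ * Real.log B < pressure ρ := by
  obtain ⟨ρ', h1, h2⟩ := exists_between h
  have h3 : ρ' * Real.log B ≤ pressure ρ' := by
    by_contra! hn
    exact (criticalExponent_le (hρ.trans h1) hB hn).not_gt h2
  have h4 := pressure_anti hρ h1.le (h2.le.trans (criticalExponent_le_two B))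
  have h5 := mul_lt_mul_of_pos_right h1 (Real.log_pos hB)
  linarith

lemma sLevel_le {n : ℕ} {B ρ : ℝ} (hρ : 0 < ρ) (h : g n ρ B ≤ 1) : sLevel n B ≤ (ρ : EReal) :=
  sInf_le ⟨ρ, ⟨hρ, h⟩, rfl⟩

lemma le_sLevel {n : ℕ} {B c : ℝ} (h : ∀ ρ, 0 < ρ → ρ < c → 1 < g n ρ B) :
    (c : EReal) ≤ sLevel n B := by
  refine le_sInf ?_
  rintro _ ⟨ρ, ⟨h0, h1⟩, rfl⟩
  by_contra! hlt
  exact (h ρ h0 (EReal.coe_lt_coe_iff.1 hlt)).not_ge h1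

lemma one_le_sLevel {n : ℕ} (hn : 0 < n) {B : ℝ} (hB : 1 < B) : ((1 : ℝ) : EReal) ≤ sLevel n B := by
  obtain ⟨m, rfl⟩ := Nat.exists_eq_succ_of_ne_zero hn.ne'
  refine le_sLevel fun ρ _ h => ?_
  have hB0 : 0 < B := by linarith
  rw [g_eq _ _ hB0, Nat.succ_eq_add_one, partitionFn_eq_top m h.le, ENNReal.mul_top]
  · exact ENNReal.one_lt_top
  · exact (ENNReal.ofReal_pos.2 (by positivity)).ne'

lemma tendsto_sLevel {B : ℝ} (hB : 1 < B) :
    Tendsto (fun n => sLevel n B) atTop (𝓝 (criticalExponent B : EReal)) := by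
  refine tendsto_order.2 ⟨fun c hc => ?_, fun c hc => ?_⟩
  · obtain ⟨r, h1, h2⟩ := EReal.lt_iff_exists_real_btwn.1 hc
    rw [EReal.coe_lt_coe_iff] at h2
    rcases le_or_gt r 1 with hr | hr
    · filter_upwards [eventually_gt_atTop 0] with n hn
      exact h1.trans_le ((EReal.coe_le_coe_iff.2 hr).trans (one_le_sLevel hn hB))
    · filter_upwards [eventually_one_lt_g hr (h2.le.trans (criticalExponent_le_two B)) hB
        (lt_pressure_of_lt_criticalExponent hr hB h2), eventually_g_anti hB] with n hn hanti
      exact h1.trans_le (le_sLevel fun ρ _ hρ => hn.trans_le (hanti ρ r hρ.le))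
  · obtain ⟨r, h1, h2⟩ := EReal.lt_iff_exists_real_btwn.1 hc
    rw [EReal.coe_lt_coe_iff] at h1
    -- If r exceeds 2, the exponent 2 serves instead, since P(2) ≤ 0 < 2 log B.
    obtain ⟨ρ, hρ, hρ2, hρr, hP⟩ : ∃ ρ : ℝ, 1 < ρ ∧ ρ ≤ 2 ∧ ρ ≤ r ∧
        pressure ρ < ρ * Real.log B := by
      rcases le_total r 2 with h | h
      · exact ⟨r, (one_le_criticalExponent B).trans_lt h1, h, le_rfl,
          pressure_lt_of_criticalExponent_lt h1 h⟩
      · exact ⟨2, one_lt_two, le_rfl, h,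
          pressure_two_nonpos.trans_lt (mul_pos two_pos (Real.log_pos hB))⟩
    filter_upwards [eventually_g_le_one hρ hρ2 hB hP] with n hn
    exact ((sLevel_le (by linarith) hn).trans (EReal.coe_le_coe_iff.2 hρr)).trans_lt h2

lemma s_eq_criticalExponent {B : ℝ} (hB : 1 < B) : s B = criticalExponent B := by
  rw [s, (tendsto_sLevel hB).limUnder_eq, EReal.toReal_coe]

/-! ### Behaviour in B -/

lemma tendsto_criticalExponent_one :
    Tendsto criticalExponent (𝓝[>] (1 : ℝ)) (𝓝 2) := by
  refine tendsto_order.2 ⟨fun c hc => ?_, fun c hc =>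
    Eventually.of_forall fun B => (criticalExponent_le_two B).trans_lt hc⟩
  obtain ⟨ρ, h1, h2⟩ := exists_between (max_lt hc (one_lt_two (α := ℝ)))
  rw [max_lt_iff] at h1
  have hP : 0 < pressure ρ :=
    (mul_pos (sub_pos.2 h2) (Real.log_pos one_lt_two)).trans_le (le_pressure h1.2 h2.le)
  have hlog : Tendsto (fun B => ρ * Real.log B) (𝓝[>] (1 : ℝ)) (𝓝 0) := by
    have := ((Real.continuousAt_log (x := 1) one_ne_zero).tendsto.const_mul ρ).mono_left
      (nhdsWithin_le_nhds (s := Ioi 1))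
    simpa using this
  filter_upwards [hlog.eventually_lt_const hP] with B hB
  exact h1.1.trans_le (le_criticalExponent h1.2 h2.le hB.le)

lemma tendsto_criticalExponent_atTop : Tendsto criticalExponent atTop (𝓝 1) := by
  refine tendsto_order.2 ⟨fun c hc => Eventually.of_forall fun B =>
    hc.trans_le (one_le_criticalExponent B), fun c hc => ?_⟩
  -- This ρ may exceed 2, where `pressure` is not known to be a limit. `criticalExponent_le` still
  -- applies because all admissible exponents are at most 2.
  obtain ⟨ρ, h1, h2⟩ := exists_between hc
  have hlog : Tendsto (fun B => ρ * Real.log B) atTop atTop :=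
    Real.tendsto_log_atTop.const_mul_atTop (by linarith)
  filter_upwards [hlog.eventually_gt_atTop (pressure ρ), eventually_gt_atTop 1] with B hB hB1
  exact (criticalExponent_le h1 hB1 hB).trans_lt h2

/-- At a fixed ρ on either side of the critical exponent, the inequality between P(ρ) and ρ log B is
strict, so it persists for B' near B. -/
lemma continuousAt_criticalExponent {B : ℝ} (hB : 1 < B) :
    ContinuousAt criticalExponent B := by
  have hlog : ∀ ρ : ℝ, Tendsto (fun B' => ρ * Real.log B') (𝓝 B) (𝓝 (ρ * Real.log B)) :=
    fun ρ => (Real.continuousAt_log (by linarith)).tendsto.const_mul ρ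
  refine tendsto_order.2 ⟨fun c hc => ?_, fun c hc => ?_⟩
  · rcases lt_or_ge c 1 with h | h
    · exact Eventually.of_forall fun B' => h.trans_le (one_le_criticalExponent B')
    · obtain ⟨ρ, h1, h2⟩ := exists_between hc
      have hρ := h.trans_lt h1
      filter_upwards [(hlog ρ).eventually_lt_const
        (lt_pressure_of_lt_criticalExponent hρ hB h2)] with B' hB'
      exact h1.trans_le (le_criticalExponent hρ (h2.le.trans (criticalExponent_le_two B)) hB'.le)
  · rcases lt_or_ge 2 c with h | h
    · exact Eventually.of_forall fun B' => (criticalExponent_le_two B').trans_lt h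
    · obtain ⟨ρ, h1, h2⟩ := exists_between hc
      filter_upwards [(hlog ρ).eventually_const_lt
        (pressure_lt_of_criticalExponent_lt h1 (h2.le.trans h)), lt_mem_nhds hB] with B' hB' hB1
      exact (criticalExponent_le ((one_le_criticalExponent B).trans_lt h1) hB1 hB').trans_lt h2

end HurwitzCF

end

theorem mainTheorem5 :
    -- the limit defining `s_B` exists and is finite
    (∀ B : ℝ, 1 < B →
      Tendsto (fun n : ℕ => HurwitzCF.sLevel n B) atTop (𝓝 ((HurwitzCF.s B : ℝ) : EReal))) ∧
    Tendsto HurwitzCF.s (𝓝[>] (1 : ℝ)) (𝓝 2) ∧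
    Tendsto HurwitzCF.s atTop (𝓝 1) ∧
    ContinuousOn HurwitzCF.s (Ioi 1) := by 
  refine ⟨fun B hB => ?_, ?_, ?_, fun B hB => ?_⟩
  · rw [HurwitzCF.s_eq_criticalExponent hB]
    exact HurwitzCF.tendsto_sLevel hB
  · refine HurwitzCF.tendsto_criticalExponent_one.congr' ?_
    filter_upwards [self_mem_nhdsWithin] with B hB
    exact (HurwitzCF.s_eq_criticalExponent hB).symm
  · refine HurwitzCF.tendsto_criticalExponent_atTop.congr' ?_
    filter_upwards [eventually_gt_atTop 1] with B hB
    exact (HurwitzCF.s_eq_criticalExponent hB).symm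
  · refine ((HurwitzCF.continuousAt_criticalExponent hB).congr ?_).continuousWithinAt
    filter_upwards [lt_mem_nhds hB] with B' hB'
    exact (HurwitzCF.s_eq_criticalExponent hB').symm
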